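/- Let $G$ be the real $4\times4$ matrix $$G=\begin{pmatrix}\sqrt2&0&0&1\\0&-\sqrt2&1&0\\0&-1&\sqrt2&0\\-1&0&0&-\sqrt2\end{pmatrix},$$ which satisfies $G^2=I$, let $E\subset\mathbb R^4$ be its eigenspace for the eigenvalue $1$, and let the group $\{I,G\}$ act on $\mathbb R^4\setminus E$ by matrix multiplication; this action is free. Put $M=(\mathbb R^4\setminus E)/\{I,G\}$ and let $\pi:\mathbb R^4\setminus E\to M$ be the projection. On $\mathbb R^4\setminus E$, with coordinates $x^1,\dots,x^4$, let $$\alpha=x^1dx^4-x^4dx^1,\qquad \beta=x^2dx^3-x^3dx^2,\qquad \theta=\begin{pmatrix}0&\alpha&0&\beta\\-\alpha&0&-\beta&0\\0&-\beta&0&\alpha\\\beta&0&-\alpha&0\end{pmatrix},$$ and let $\nabla'$ be the linear connection with $\nabla'_X dx^j=-\sum_l\theta^j_l(X)\,dx^l$, equivalently $\nabla'_X\partial_l=\sum_j\theta^j_l(X)\,\partial_j$. Let $$K=\begin{pmatrix}I_2&0\\0&-I_2\end{pmatrix},\qquad L=\begin{pmatrix}0&I_2\\I_2&0\end{pmatrix}.$$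 Then $M$ is a connected smooth (Hausdorff, second countable) four-dimensional manifold, with $\pi$ a local diffeomorphism, and $M$ is not simply connected. The connection $\nabla'$ and the semi-Riemannian metrics $\sum K_{ij}\,dx^i\otimes dx^j$ and $\sum L_{ij}\,dx^i\otimes dx^j$ project under $\pi$ to a smooth linear connection $\nabla$ and smooth semi-Riemannian metrics $g_1,g_2$ on $M$. The metrics $g_1$ and $g_2$ have signature $(2,2)$, are linearly independent at every point of $M$, and are parallel with respect to $\nabla$. Moreover, $\nabla$ has irreducible holonomy: for every $x\in M$, the group of parallel transports around piecewise smooth loops based at $x$ leaves invariant no linear subspace of $T_xM$ other than $0$ and $T_xM$. -/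

import Mathlib

open scoped Manifold ContDiff Topology Matrix
open Bundle

noncomputable section

/-! ### Connections, parallel metrics and holonomy on a manifold -/

namespace ParallelMetrics

section General

variable {E : Type*} [NormedAddCommGroup E] [NormedSpace ℝ E]
  {H : Type*} [TopologicalSpace H] (I : ModelWithCorners ℝ E H)
  (M : Type*) [TopologicalSpace M] [ChartedSpace H M] [IsManifold I ∞ M]

/-- A linear connection on `M`: a covariant derivative on the tangent bundle. The value
`D Y x v` is `∇_v Y` at the point `x`. -/
abbrev LinearConnection := CovariantDerivative I E (TangentSpace I : M → Type _)

/-- A smooth semi-Riemannian metric: a smooth field of nondegenerate symmetric bilinear forms on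
the tangent spaces. -/
structure SemiRiemannianMetric where
  /-- the bilinear form on each tangent space -/
  form (x : M) : TangentSpace I x →L[ℝ] TangentSpace I x →L[ℝ] ℝ
  symm (x : M) (v w : TangentSpace I x) : form x v w = form x w v
  nondegenerate (x : M) (v : TangentSpace I x) (hv : ∀ w, form x v w = 0) : v = 0
  contMDiff : ContMDiff I (I.prod 𝓘(ℝ, E →L[ℝ] E →L[ℝ] ℝ)) ∞
    (fun x ↦ TotalSpace.mk' (E →L[ℝ] E →L[ℝ] ℝ)
      (E := fun x : M ↦ TangentSpace I x →L[ℝ] TangentSpace I x →L[ℝ] ℝ) x (form x))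

variable {I M}

/-- The quadratic form `v ↦ g(v, v)` on the tangent space at `x`. -/
def SemiRiemannianMetric.quadraticForm (g : SemiRiemannianMetric I M) (x : M) :
    QuadraticForm ℝ (TangentSpace I x) :=
  LinearMap.BilinMap.toQuadraticMap
    (LinearMap.mk₂ ℝ (fun v w ↦ g.form x v w) (by simp) (by simp) (by simp) (by simp))

/-- `g` has signature `(p, q)` at every point. -/
def SemiRiemannianMetric.HasSignature (g : SemiRiemannianMetric I M) (p q : ℕ) : Prop :=
  ∀ x : M, sigPos (g.quadraticForm x) = p ∧ sigNeg (g.quadraticForm x) = q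

/-- `∇ g = 0`: `v (g(Y, Z)) = g(∇_v Y, Z) + g(Y, ∇_v Z)` for all vector fields `Y`, `Z`
differentiable at the point and all tangent vectors `v` there. -/
def SemiRiemannianMetric.IsParallel (g : SemiRiemannianMetric I M)
    (D : LinearConnection I M) : Prop :=
  ∀ (x : M) (Y Z : Π x : M, TangentSpace I x),
    MDifferentiableAt I I.tangent (fun y ↦ (⟨y, Y y⟩ : TangentBundle I M)) x →
    MDifferentiableAt I I.tangent (fun y ↦ (⟨y, Z y⟩ : TangentBundle I M)) x →
    ∀ v : TangentSpace I x,
      mvfderiv I (fun y ↦ g.form y (Y y) (Z y)) x v =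
        g.form x (D Y x v) (Z x) + g.form x (Y x) (D Z x v)

/-- The coordinates of `w : T_y M` with respect to the coordinate frame of the preferred chart
at `x` (meaningful for `y` in the domain of that chart). -/
def chartCoord (x : M) (y : M) (w : TangentSpace I y) : E :=
  (trivializationAt E (TangentSpace I : M → Type _) x ⟨y, w⟩).2

theorem chartCoord_neg (x : M) (w : TangentSpace I x) :
    chartCoord x x (-w) = -chartCoord x x w :=
  ((trivializationAt E (TangentSpace I : M → Type _) x).linear ℝ
    (FiberBundle.mem_baseSet_trivializationAt' x)).map_neg w

/-- The vector field with constant coefficients, in the coordinate frame of the preferred chart at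
`x`, whose value at `x` is `w`. -/
def constantField (x : M) (w : TangentSpace I x) (y : M) : TangentSpace I y :=
  (trivializationAt E (TangentSpace I : M → Type _) x).symm y (chartCoord x x w)

/-- The velocity vector at time `t` of a curve `γ : [0,1] → M`. -/
def velocity (γ : ℝ → M) (t : ℝ) : TangentSpace I (γ t) :=
  mfderivWithin 𝓘(ℝ, ℝ) I γ (Set.Icc 0 1) t (1 : ℝ)

/-- A vector field `V` along a curve `γ : [0,1] → M` is parallel: for each `t`, in the
coordinate frame `(∂_i)` of the chart at `γ t`, writing `V = ∑ V^i ∂_i`, one has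
`∑ (dV^i/dt) ∂_i + ∑ V^i ∇_{γ'} ∂_i = 0` at the time `t`. -/
def IsParallelAlong (D : LinearConnection I M) (γ : ℝ → M)
    (V : Π t : ℝ, TangentSpace I (γ t)) : Prop :=
  ∀ t ∈ Set.Icc (0 : ℝ) 1,
    HasDerivWithinAt (fun s ↦ chartCoord (γ t) (γ s) (V s))
      (chartCoord (γ t) (γ t) (-(D (constantField (γ t) (V t)) (γ t) (velocity γ t))))
      (Set.Icc 0 1) t

/-- `P : T_x M → T_y M` is the parallel transport along a smooth curve `γ : [0,1] → M` from
`x` to `y`. -/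
def IsTransportAlongSmooth (D : LinearConnection I M) (x y : M)
    (P : TangentSpace I x ≃ₗ[ℝ] TangentSpace I y) : Prop :=
  ∃ γ : ℝ → M, ContMDiffOn 𝓘(ℝ, ℝ) I ∞ γ (Set.Icc 0 1) ∧ γ 0 = x ∧ γ 1 = y ∧
    ∀ v : TangentSpace I x, ∃ V : Π t : ℝ, TangentSpace I (γ t),
      IsParallelAlong D γ V ∧
      (⟨γ 0, V 0⟩ : TangentBundle I M) = ⟨x, v⟩ ∧
      (⟨γ 1, V 1⟩ : TangentBundle I M) = ⟨y, P v⟩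

/-- `P : T_x M → T_y M` is the parallel transport along a piecewise smooth curve from `x` to
`y`, that is, a composition of parallel transports along consecutive smooth curves. -/
inductive IsTransport (D : LinearConnection I M) :
    (x y : M) → (TangentSpace I x ≃ₗ[ℝ] TangentSpace I y) → Prop
  | refl (x : M) : IsTransport D x x (LinearEquiv.refl ℝ _)
  | snoc {x y z : M} {P : TangentSpace I x ≃ₗ[ℝ] TangentSpace I y}
      {Q : TangentSpace I y ≃ₗ[ℝ] TangentSpace I z} :
      IsTransport D x y P → IsTransportAlongSmooth D y z Q → IsTransport D x z (P.trans Q)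

theorem IsTransport.trans {D : LinearConnection I M} {x y z : M}
    {P : TangentSpace I x ≃ₗ[ℝ] TangentSpace I y} {Q : TangentSpace I y ≃ₗ[ℝ] TangentSpace I z}
    (hP : IsTransport D x y P) (hQ : IsTransport D y z Q) : IsTransport D x z (P.trans Q) := by
  induction hQ with
  | refl => exact hP
  | snoc _ h ih => exact ih.snoc h

theorem IsTransportAlongSmooth.symm {D : LinearConnection I M} {x y : M}
    {P : TangentSpace I x ≃ₗ[ℝ] TangentSpace I y} (h : IsTransportAlongSmooth D x y P) :
    IsTransportAlongSmooth D y x P.symm := by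
  obtain ⟨γ, hγ, h0, h1, hV⟩ := h
  have hmaps : Set.MapsTo (fun t : ℝ ↦ 1 - t) (Set.Icc 0 1) (Set.Icc 0 1) := by
    intro t ht
    simp only [Set.mem_Icc] at ht ⊢
    constructor <;> linarith [ht.1, ht.2]
  have hder (t : ℝ) : HasDerivWithinAt (fun t : ℝ ↦ 1 - t) (-1) (Set.Icc 0 1) t := by
    simpa using (hasDerivWithinAt_id t (Set.Icc (0 : ℝ) 1)).const_sub 1
  refine ⟨fun t ↦ γ (1 - t), ?_, by simpa using h1, by simpa using h0, fun v ↦ ?_⟩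
  · exact hγ.comp (contMDiffOn_iff_contDiffOn.2 (by fun_prop)) hmaps
  · obtain ⟨V, hpar, hV0, hV1⟩ := hV (P.symm v)
    have key (s t : ℝ) (hst : s = t) :
        (⟨γ s, V s⟩ : TangentBundle I M) = ⟨γ t, V t⟩ := by rw [hst]
    refine ⟨fun t ↦ V (1 - t), fun t ht ↦ ?_, ?_, ?_⟩
    · have hvel : velocity (I := I) (fun t ↦ γ (1 - t)) t = -velocity (I := I) γ (1 - t) := by
        have hu : UniqueMDiffWithinAt 𝓘(ℝ, ℝ) (Set.Icc (0 : ℝ) 1) t :=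
          ((uniqueDiffOn_Icc zero_lt_one) t ht).uniqueMDiffWithinAt
        have hc := mfderivWithin_comp (I := 𝓘(ℝ, ℝ)) (I' := 𝓘(ℝ, ℝ)) (I'' := I) t
          (g := γ) (f := fun t : ℝ ↦ 1 - t) (u := Set.Icc 0 1) (s := Set.Icc 0 1)
          ((hγ (1 - t) (hmaps ht)).mdifferentiableWithinAt (by simp))
          (hder t).differentiableWithinAt.mdifferentiableWithinAt hmaps hu
        have hf : mfderivWithin 𝓘(ℝ, ℝ) 𝓘(ℝ, ℝ) (fun t : ℝ ↦ 1 - t) (Set.Icc 0 1) t (1 : ℝ)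
            = (-1 : ℝ) := by
          rw [mfderivWithin_eq_fderivWithin]
          exact fderivWithin_derivWithin.trans
            ((hder t).derivWithin ((uniqueDiffOn_Icc zero_lt_one) t ht))
        have hc' := congrArg (fun L ↦ L (1 : ℝ)) hc
        refine hc'.trans ?_
        refine (congrArg (mfderivWithin 𝓘(ℝ, ℝ) I γ (Set.Icc 0 1) (1 - t)) hf).trans ?_
        exact map_neg (mfderivWithin 𝓘(ℝ, ℝ) I γ (Set.Icc 0 1) (1 - t)) (1 : ℝ)
      have h2 := (hpar (1 - t) (hmaps ht)).scomp t (hder t) hmaps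
      refine h2.congr_deriv ?_
      rw [hvel, map_neg, neg_neg, chartCoord_neg, smul_neg, neg_smul, one_smul, neg_neg]
    · exact (key (1 - 0) 1 (by norm_num)).trans (by simpa using hV1)
    · exact (key (1 - 1) 0 (by norm_num)).trans hV0

theorem IsTransport.symm {D : LinearConnection I M} {x y : M}
    {P : TangentSpace I x ≃ₗ[ℝ] TangentSpace I y} (h : IsTransport D x y P) :
    IsTransport D y x P.symm := by
  induction h with
  | refl => exact IsTransport.refl _
  | snoc _ h ih => exact ((IsTransport.refl _).snoc h.symm).trans ih

/-- The holonomy group at `x`: all parallel transports around piecewise smooth loops at `x`. -/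
def holonomyGroup (D : LinearConnection I M) (x : M) :
    Subgroup (TangentSpace I x ≃ₗ[ℝ] TangentSpace I x) where
  carrier := {P | IsTransport D x x P}
  one_mem' := IsTransport.refl x
  mul_mem' hP hQ := hQ.trans hP
  inv_mem' hP := hP.symm

/-- A group of linear automorphisms acts irreducibly: there is no invariant subspace other than
the zero space and the whole space. -/
def ActsIrreducibly {V : Type*} [AddCommGroup V] [Module ℝ V] (Γ : Subgroup (V ≃ₗ[ℝ] V)) : Prop :=
  ∀ W : Submodule ℝ V, (∀ P ∈ Γ, ∀ w ∈ W, P w ∈ W) → W = ⊥ ∨ W = ⊤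

/-- The holonomy group acts irreducibly on the tangent space, at every point. -/
def HasIrreducibleHolonomy (D : LinearConnection I M) : Prop :=
  ∀ x : M, ActsIrreducibly (holonomyGroup D x)

/-- A local diffeomorphism `f : N → M` maps the connection `D'` on `N` to the connection `D` on
`M`: `df (∇'_v (f^* Y)) = ∇_{df v} Y` for every vector field `Y` on `M`, where `f^* Y` is the
vector field on `N` with `df (f^* Y) = Y ∘ f`. -/
def ProjectsTo {N : Type*} [TopologicalSpace N] [ChartedSpace H N] [IsManifold I ∞ N]
    (f : N → M) (D' : LinearConnection I N) (D : LinearConnection I M) : Prop :=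
  ∀ (x : N) (Y : Π y : M, TangentSpace I y),
    MDifferentiableAt I I.tangent (fun y ↦ (⟨y, Y y⟩ : TangentBundle I M)) (f x) →
    ∀ v : TangentSpace I x,
      mfderiv I I f x (D' (VectorField.mpullback I I f Y) x v) = D Y (f x) (mfderiv I I f x v)

end General

/-! ### The manifold `M = (ℝ⁴ ∖ E) / {I, G}` -/

/-- `ℝ⁴`; the coordinates `x¹, x², x³, x⁴` are `x 0, x 1, x 2, x 3`. -/
abbrev R4 := EuclideanSpace ℝ (Fin 4)

/-- The matrix `G`. -/
def matG : Matrix (Fin 4) (Fin 4) ℝ :=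
  !![√2, 0, 0, 1;
     0, -√2, 1, 0;
     0, -1, √2, 0;
     -1, 0, 0, -√2]

/-- The matrix `K` of the first metric. -/
def matK : Matrix (Fin 4) (Fin 4) ℝ :=
  !![1, 0, 0, 0;
     0, 1, 0, 0;
     0, 0, -1, 0;
     0, 0, 0, -1]

/-- The matrix `L` of the second metric. -/
def matL : Matrix (Fin 4) (Fin 4) ℝ :=
  !![0, 0, 1, 0;
     0, 0, 0, 1;
     1, 0, 0, 0;
     0, 1, 0, 0]

theorem matG_mul_self : matG * matG = 1 := by
  have h : √2 * √2 = 2 := by norm_num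
  ext i j
  fin_cases i <;> fin_cases j <;> simp [matG, Matrix.mul_apply, Fin.sum_univ_four, h] <;> norm_num

/-- `G` as an element of `GL(4, ℝ)`. -/
def unitG : GL (Fin 4) ℝ := ⟨matG, matG, matG_mul_self, matG_mul_self⟩

theorem unitG_mul_self : unitG * unitG = 1 := Units.ext matG_mul_self

/-- The group `{I, G}`. -/
def groupG : Subgroup (GL (Fin 4) ℝ) where
  carrier := {1, unitG}
  one_mem' := Or.inl rfl
  mul_mem' := by
    rintro a b (rfl | rfl) (rfl | rfl) <;> simp [unitG_mul_self]
  inv_mem' := by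
    rintro a (rfl | rfl)
    · simp
    · exact Or.inr (inv_eq_of_mul_eq_one_left unitG_mul_self)

instance : Finite groupG := Set.Finite.to_subtype (s := {1, unitG}) (by simp)

/-- The eigenspace `E` of `G` for the eigenvalue `1`. -/
def eigenE : Submodule ℝ R4 := Module.End.eigenspace (Matrix.toEuclideanLin matG) 1

/-- The open submanifold `ℝ⁴ ∖ E` of `ℝ⁴`. -/
def cover : TopologicalSpace.Opens R4 :=
  ⟨(eigenE : Set R4)ᶜ, eigenE.closed_of_finiteDimensional.isOpen_compl⟩

theorem mem_eigenE {x : R4} : x ∈ eigenE ↔ Matrix.toEuclideanLin matG x = x := by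
  simp [eigenE]

theorem toEuclideanLin_matG_matG (x : R4) :
    Matrix.toEuclideanLin matG (Matrix.toEuclideanLin matG x) = x := by
  simp [Matrix.toLpLin_apply, matG_mul_self]

theorem groupG_maps_cover (g : groupG) (x : cover) :
    Matrix.toEuclideanLin (g : GL (Fin 4) ℝ).1 x ∈ cover := by
  obtain ⟨g, rfl | rfl⟩ := g
  · simp
  · intro h
    refine x.2 ?_
    have h' := mem_eigenE.1 h
    rw [show ((⟨unitG, Or.inr rfl⟩ : groupG) : GL (Fin 4) ℝ).1 = matG from rfl,
      toEuclideanLin_matG_matG] at h'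
    exact mem_eigenE.2 h'.symm

/-- `{I, G}` acts on `ℝ⁴ ∖ E` by matrix multiplication. -/
instance : MulAction groupG cover where
  smul g x := ⟨Matrix.toEuclideanLin (g : GL (Fin 4) ℝ).1 x, groupG_maps_cover g x⟩
  one_smul x := Subtype.ext (by
    change Matrix.toEuclideanLin (1 : Matrix (Fin 4) (Fin 4) ℝ) (x : R4) = x
    simp)
  mul_smul g h x := Subtype.ext (by
    change Matrix.toEuclideanLin ((g : GL (Fin 4) ℝ).1 * (h : GL (Fin 4) ℝ).1) (x : R4) =
      Matrix.toEuclideanLin (g : GL (Fin 4) ℝ).1 (Matrix.toEuclideanLin (h : GL (Fin 4) ℝ).1 x)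
    simp [Matrix.toLpLin_apply])

theorem coe_smul (g : groupG) (x : cover) :
    ((g • x : cover) : R4) = Matrix.toEuclideanLin (g : GL (Fin 4) ℝ).1 x := rfl

instance : ContinuousConstSMul groupG cover where
  continuous_const_smul _ := Continuous.subtype_mk
    ((LinearMap.continuous_of_finiteDimensional _).comp continuous_subtype_val) _

theorem unitG_smul_ne (x : cover) : (⟨unitG, Or.inr rfl⟩ : groupG) • x ≠ x := fun h ↦
  x.2 (mem_eigenE.2 (congrArg Subtype.val h))

instance : IsCancelSMul groupG cover where
  left_cancel' g x y h := MulAction.injective g h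
  right_cancel' := by
    rintro ⟨a, rfl | rfl⟩ ⟨b, rfl | rfl⟩ x h
    · rfl
    · exact (unitG_smul_ne x (h.symm.trans (one_smul groupG x))).elim
    · exact (unitG_smul_ne x (h.trans (one_smul groupG x))).elim
    · rfl

instance : LocallyCompactSpace cover := cover.isOpen.locallyCompactSpace

/-- The quotient `M = (ℝ⁴ ∖ E) / {I, G}`, with the quotient topology and the charts obtained
from those of `ℝ⁴ ∖ E` through the covering map. -/
abbrev quotientM : Type := MulAction.orbitRel.Quotient groupG cover

/-- The projection `ℝ⁴ ∖ E → M`. -/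
def proj : cover → quotientM := Quotient.mk _

/-- The 1-form `α = x¹ dx⁴ - x⁴ dx¹` at `x`, evaluated on `v`. -/
def formAlpha (x v : R4) : ℝ := x 0 * v 3 - x 3 * v 0

/-- The 1-form `β = x² dx³ - x³ dx²` at `x`, evaluated on `v`. -/
def formBeta (x v : R4) : ℝ := x 1 * v 2 - x 2 * v 1

/-- The matrix `θ` of 1-forms at `x`, evaluated on `v`. -/
def formTheta (x v : R4) : Matrix (Fin 4) (Fin 4) ℝ :=
  !![0, formAlpha x v, 0, formBeta x v;
     -formAlpha x v, 0, -formBeta x v, 0;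
     0, -formBeta x v, 0, formAlpha x v;
     formBeta x v, 0, -formAlpha x v, 0]

/-- The bilinear map `(w, v) ↦ θ(v) w` at `x`. -/
def thetaBilin (x : R4) : R4 →L[ℝ] R4 →L[ℝ] R4 :=
  (LinearMap.mk₂ ℝ (fun w v ↦ Matrix.toEuclideanLin (formTheta x v) w)
    (by simp) (by simp)
    (fun w v v' ↦ by
      rw [← LinearMap.add_apply, ← map_add]
      congr 2
      ext i j
      fin_cases i <;> fin_cases j <;> simp [formTheta, formAlpha, formBeta] <;> ring)
    (fun c w v ↦ by
      rw [← LinearMap.smul_apply, ← map_smul]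
      congr 2
      ext i j
      fin_cases i <;> fin_cases j <;> simp [formTheta, formAlpha, formBeta] <;> ring)
    ).toContinuousBilinearMap

/-- The components of a vector field on `ℝ⁴ ∖ E` with respect to `∂/∂x¹, …, ∂/∂x⁴`. Tangent
spaces of `ℝ⁴ ∖ E` are `ℝ⁴`, since the chart of `ℝ⁴ ∖ E` is the inclusion. -/
def components (Y : Π y : cover, TangentSpace 𝓘(ℝ, R4) y) : cover → R4 := fun y ↦ Y y

theorem trivializationAt_cover (x : cover) (z : TangentBundle 𝓘(ℝ, R4) cover) :
    (trivializationAt R4 (TangentSpace 𝓘(ℝ, R4) : cover → Type _) x z).2 = z.2 := by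
  rw [TangentBundle.trivializationAt_apply]
  have h := TopologicalSpace.Opens.chartAt_subtype_val_symm_eventuallyEq (H := R4) cover (x := z.1)
  have h2 : ((chartAt R4 x).extend 𝓘(ℝ, R4) ∘ ((chartAt R4 z.1).extend 𝓘(ℝ, R4)).symm)
      =ᶠ[𝓝 ((chartAt R4 z.1).extend 𝓘(ℝ, R4) z.1)] id :=
    h.symm
  simp only [modelWithCornersSelf_coe, Set.range_id, fderivWithin_univ]
  rw [h2.fderiv_eq, fderiv_id]
  rfl

theorem mdifferentiableAt_components {x : cover} {Y : Π y : cover, TangentSpace 𝓘(ℝ, R4) y}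
    (hY : MDifferentiableAt 𝓘(ℝ, R4) 𝓘(ℝ, R4).tangent
      (fun y ↦ (⟨y, Y y⟩ : TangentBundle 𝓘(ℝ, R4) cover)) x) :
    MDifferentiableAt 𝓘(ℝ, R4) 𝓘(ℝ, R4) (components Y) x := by
  have h := (mdifferentiableAt_section _ _).1 hY
  have h2 : (fun y ↦ (trivializationAt R4 (TangentSpace 𝓘(ℝ, R4) : cover → Type _) x
      ⟨y, Y y⟩).2) = components Y := funext fun y ↦ trivializationAt_cover x ⟨y, Y y⟩
  rwa [h2] at h

/-- The flat connection on `ℝ⁴ ∖ E`: `∇_v Y` is the derivative of the components of `Y`. -/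
def flatConnection : LinearConnection 𝓘(ℝ, R4) cover where
  toFun Y x := mvfderiv 𝓘(ℝ, R4) (components Y) x
  isCovariantDerivativeOnUniv :=
    { add := fun hY hZ _ ↦
        mvfderiv_add (mdifferentiableAt_components hY) (mdifferentiableAt_components hZ)
      leibniz := fun hY hf _ ↦ mvfderiv_smul hf (mdifferentiableAt_components hY) }

/-- `θ` on the tangent spaces of `ℝ⁴ ∖ E`: `thetaTensor x w v` is `θ(v) w` at `x`. -/
def thetaTensor (x : cover) : TangentSpace 𝓘(ℝ, R4) x →L[ℝ]
    TangentSpace 𝓘(ℝ, R4) x →L[ℝ] TangentSpace 𝓘(ℝ, R4) x := thetaBilin x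

/-- The connection on `ℝ⁴ ∖ E` with `∇_v (∂/∂xˡ) = ∑ⱼ θʲₗ(v) ∂/∂xʲ`, equivalently
`∇_v dxʲ = -∑ₗ θʲₗ(v) dxˡ`; that is, `∇_v Y = v(Y) + θ(v) Y` on components. -/
def coverConnection : LinearConnection 𝓘(ℝ, R4) cover :=
  flatConnection.addOneForm thetaTensor

/-- The value at `x` of the constant-coefficient symmetric form `∑ C i j dxⁱ ⊗ dxʲ` on `v, w`. -/
def constForm (C : Matrix (Fin 4) (Fin 4) ℝ) (v w : R4) : ℝ := ∑ i, ∑ j, C i j * v i * w j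

end ParallelMetrics

end

open ParallelMetrics

noncomputable section

namespace ParallelMetrics

/-! Write θ = αA + βB with constant matrices A and B (`opA`, `opB`). They commute, A² = -1, B² = 1,
and both are skew for K and L. Hence the constant forms K and L are parallel for ∇'
(`isParallel_quotientMetric`). The matrix G preserves K and L, reverses the signs of α and β, and
anticommutes with A and B. In θ these signs cancel (`thetaBilin_linAct`), so the connection and both
metrics descend to M.

The topology comes from E having codimension two. Its complement is path connected, so π is a
connected double covering, and π₁(M) maps onto the group of order two.

For the holonomy, the relations between A and B give exp(-(aA + bB)) in closed form (`expOp`). Since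
α and β are alternating bilinear in position and velocity, the transport equation along a straight
segment from x to y has constant coefficients, with solution exp(-(α(x,y)A + β(x,y)B)) at the end
(`isCoverTransport_segment`). Small triangles at x realize exp(-sA) and exp(-sB) for some s > 0, so
every invariant subspace is stable under A and B. A path from x to Gx becomes a loop in M whose
transport is such an exponential followed by G, so the subspace is stable under G as well.

These three matrices have no common proper invariant subspace (`eq_bot_or_eq_top`). The eigenspaces
of B are two planes, A acts on each as a complex structure, and G exchanges the two because it
anticommutes with B.

Throughout, the chart of M at q is built from one chosen lift `rep q`. In the preferred charts dπ at
x is therefore the group element `deck x` that moves x to the chosen lift, and each computation on M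
becomes one on ℝ⁴ up to such a matrix. -/

/-- The linear automorphism of `ℝ⁴` given by an element of `{I, G}`. -/
def linAct (g : groupG) : R4 →L[ℝ] R4 :=
  LinearMap.toContinuousLinearMap (Matrix.toEuclideanLin (g : GL (Fin 4) ℝ).1)

theorem coe_smul_eq_linAct (g : groupG) (x : cover) : ((g • x : cover) : R4) = linAct g x := rfl

theorem linAct_one (x : R4) : linAct 1 x = x := by
  change Matrix.toEuclideanLin (1 : Matrix (Fin 4) (Fin 4) ℝ) x = x
  simp

theorem linAct_mul (g h : groupG) (x : R4) : linAct (g * h) x = linAct g (linAct h x) := by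
  change Matrix.toEuclideanLin ((g : GL (Fin 4) ℝ).1 * (h : GL (Fin 4) ℝ).1) x =
    Matrix.toEuclideanLin (g : GL (Fin 4) ℝ).1 (Matrix.toEuclideanLin (h : GL (Fin 4) ℝ).1 x)
  simp [Matrix.toLpLin_apply]

theorem linAct_inv_linAct (g : groupG) (x : R4) : linAct g⁻¹ (linAct g x) = x := by
  rw [← linAct_mul, inv_mul_cancel, linAct_one]

theorem linAct_linAct_inv (g : groupG) (x : R4) : linAct g (linAct g⁻¹ x) = x := by
  rw [← linAct_mul, mul_inv_cancel, linAct_one]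

/-- The continuous linear equivalence given by an element of `{I, G}`. -/
def linActEquiv (g : groupG) : R4 ≃L[ℝ] R4 :=
  ContinuousLinearEquiv.equivOfInverse (linAct g) (linAct g⁻¹) (linAct_inv_linAct g)
    (linAct_linAct_inv g)

/-! ### The covering ℝ⁴ ∖ E → M -/

theorem isQuotientCoveringMap_proj : IsQuotientCoveringMap proj groupG :=
  isQuotientCoveringMap_quotientMk_of_properlyDiscontinuousSMul

theorem isLocalHomeomorph_proj : IsLocalHomeomorph proj :=
  isQuotientCoveringMap_proj.isCoveringMap.isLocalHomeomorph

theorem proj_surjective : Function.Surjective proj := Quotient.mk_surjective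

theorem continuous_proj : Continuous proj := isLocalHomeomorph_proj.continuous

theorem proj_eq_proj_iff {x y : cover} : proj x = proj y ↔ ∃ g : groupG, g • y = x :=
  isQuotientCoveringMap_proj.apply_eq_iff_mem_orbit

theorem proj_smul (g : groupG) (x : cover) : proj (g • x) = proj x :=
  proj_eq_proj_iff.2 ⟨g, rfl⟩

/-- The point over `q` that is used for the preferred chart at `q`. -/
def rep (q : quotientM) : cover := proj_surjective.hasRightInverse.choose q

@[simp] theorem proj_rep (q : quotientM) : proj (rep q) = q :=
  proj_surjective.hasRightInverse.choose_spec q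

theorem exists_smul_eq_rep (x : cover) : ∃ g : groupG, g • x = rep (proj x) :=
  proj_eq_proj_iff.1 (proj_rep _)

/-- Definitional because `rep` makes the same choice of right inverse as the charted space structure
on the quotient. -/
theorem chartAt_quotientM (q : quotientM) : chartAt R4 q =
    (isLocalHomeomorph_proj.localInverseAt (x := rep q)).trans (chartAt R4 (rep q)) := rfl

/-- Uniqueness of local lifts: π is injective near `t a`, and both `t` and `g • s` stay in that
neighbourhood and have the same projection. -/
theorem eventually_eq_smul_of_proj_eq {X : Type*} [TopologicalSpace X] {s t : X → cover} {a : X}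
    (hs : ContinuousAt s a) (ht : ContinuousAt t a) (h : ∀ᶠ b in 𝓝 a, proj (s b) = proj (t b))
    {g : groupG} (hg : t a = g • s a) : ∀ᶠ b in 𝓝 a, t b = g • s b := by
  set e := isLocalHomeomorph_proj.localInverseAt (x := t a) with he
  have hU : e.target ∈ 𝓝 (t a) := e.open_target.mem_nhds
    (isLocalHomeomorph_proj.self_mem_localInverseAt_target)
  have hs' : ContinuousAt (fun b ↦ g • s b) a := hs.const_smul g
  have hU' : e.target ∈ 𝓝 (g • s a) := by rw [← hg]; exact hU
  filter_upwards [h, ht hU, hs' hU'] with b hb h1 h2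
  refine isLocalHomeomorph_proj.injOn_localInverseAt_target h1 h2 ?_
  rw [proj_smul, hb]

/-! ### Charts and smooth structure of M -/

theorem chartAt_cover_symm {x : cover} {z : R4} (hz : z ∈ (chartAt R4 x).target) :
    (((chartAt R4 x).symm z : cover) : R4) = z :=
  (chartAt R4 x).right_inv hz

/-- A chart of M is a local inverse of π followed by the inclusion. Composed with π it is a lift of
π, hence locally one fixed group element. -/
theorem eventually_chartAt_proj {q : quotientM} {x : cover}
    (hx : proj x ∈ (chartAt R4 q).source) :
    ∃ g : groupG, ∀ᶠ y in 𝓝 x, chartAt R4 q (proj y) = linAct g y := by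
  set e := isLocalHomeomorph_proj.localInverseAt (x := rep q) with he
  have hx' : proj x ∈ e.source := by
    rw [chartAt_quotientM, OpenPartialHomeomorph.trans_source] at hx
    exact hx.1
  have hproj : ∀ p ∈ e.source, proj (e p) = p := fun p hp ↦
    isLocalHomeomorph_proj.apply_localInverseAt_of_mem hp
  obtain ⟨g, hg⟩ := proj_eq_proj_iff.1 (hproj _ hx')
  refine ⟨g, ?_⟩
  have h := eventually_eq_smul_of_proj_eq (s := id) (t := fun y ↦ e (proj y)) (a := x)
    continuousAt_id ((e.continuousAt hx').comp continuous_proj.continuousAt)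
    (by
      filter_upwards [continuous_proj.continuousAt (e.open_source.mem_nhds hx')] with y hy
      exact (hproj _ hy).symm) hg.symm
  filter_upwards [h] with y hy
  change ((e (proj y) : cover) : R4) = _
  rw [hy]; rfl

theorem eventually_chartAt_proj_self {x : cover} {g : groupG} (hg : g • x = rep (proj x)) :
    ∀ᶠ y in 𝓝 x, chartAt R4 (proj x) (proj y) = linAct g y := by
  set e := isLocalHomeomorph_proj.localInverseAt (x := rep (proj x)) with he
  have hx' : proj x ∈ e.source := by
    have := mem_chart_source R4 (proj x)
    rw [chartAt_quotientM, OpenPartialHomeomorph.trans_source] at this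
    exact this.1
  have h := eventually_eq_smul_of_proj_eq (s := id) (t := fun y ↦ e (proj y)) (a := x) (g := g)
    continuousAt_id ((e.continuousAt hx').comp continuous_proj.continuousAt)
    (by
      filter_upwards [continuous_proj.continuousAt (e.open_source.mem_nhds hx')] with y hy
      exact (isLocalHomeomorph_proj.apply_localInverseAt_of_mem hy).symm)
    (by
      have h1 : e (proj (rep (proj x))) = rep (proj x) :=
        isLocalHomeomorph_proj.localInverseAt_apply_self
      rw [proj_rep] at h1
      exact h1.trans hg.symm)
  filter_upwards [h] with y hy
  change ((e (proj y) : cover) : R4) = _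
  rw [hy]; rfl

theorem chartAt_symm_eq_proj (q : quotientM) {z : R4} :
    (chartAt R4 q).symm z = proj ((chartAt R4 (rep q)).symm z) := by
  rw [chartAt_quotientM, OpenPartialHomeomorph.coe_trans_symm, Function.comp_apply,
    isLocalHomeomorph_proj.localInverseAt_symm]

/-- The transition maps are locally restrictions of elements of {I, G}, hence linear. -/
theorem isManifold_quotientM (n : WithTop ℕ∞) : IsManifold 𝓘(ℝ, R4) n quotientM := by
  refine isManifold_of_contDiffOn _ _ _ ?_
  rintro _ _ ⟨q, rfl⟩ ⟨r, rfl⟩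
  change ContDiffOn ℝ n (((chartAt R4 q).symm.trans (chartAt R4 r)))
    (((chartAt R4 q).symm.trans (chartAt R4 r)).source ∩ Set.range id)
  rw [Set.range_id, Set.inter_univ]
  intro z hz
  rw [OpenPartialHomeomorph.trans_source, Set.mem_inter_iff, OpenPartialHomeomorph.symm_source,
    Set.mem_preimage] at hz
  have hz1 : z ∈ (chartAt R4 (rep q)).target := by
    have := hz.1
    rw [chartAt_quotientM, OpenPartialHomeomorph.trans_target] at this
    exact this.1
  obtain ⟨g, hg⟩ := eventually_chartAt_proj (q := r) (x := (chartAt R4 (rep q)).symm z)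
    (by rw [← chartAt_symm_eq_proj]; exact hz.2)
  refine ContDiffAt.contDiffWithinAt ?_
  refine (linAct g).contDiff.contDiffAt.congr_of_eventuallyEq ?_
  have hc := (chartAt R4 (rep q)).symm.continuousAt hz1
  filter_upwards [hc hg, (chartAt R4 (rep q)).open_target.mem_nhds hz1] with w hw hw1
  rw [OpenPartialHomeomorph.coe_trans, Function.comp_apply, chartAt_symm_eq_proj]
  refine hw.trans ?_
  rw [chartAt_cover_symm hw1]

instance : IsManifold 𝓘(ℝ, R4) ∞ quotientM := isManifold_quotientM ∞

section Cover

variable {E' H' N : Type*} [NormedAddCommGroup E'] [NormedSpace ℝ E'] [TopologicalSpace H']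
  {J : ModelWithCorners ℝ E' H'} [TopologicalSpace N] [ChartedSpace H' N]

theorem contMDiff_coe_cover {n : WithTop ℕ∞} :
    ContMDiff 𝓘(ℝ, R4) 𝓘(ℝ, R4) n (Subtype.val : cover → R4) := contMDiff_subtype_val

theorem contMDiffWithinAt_cover_iff {n : WithTop ℕ∞} {f : N → cover} {s : Set N} {x : N} :
    ContMDiffWithinAt J 𝓘(ℝ, R4) n f s x ↔
      ContMDiffWithinAt J 𝓘(ℝ, R4) n (fun y ↦ (f y : R4)) s x := by
  refine ⟨fun h ↦ contMDiff_coe_cover.contMDiffAt.comp_contMDiffWithinAt x h, fun h ↦ ?_⟩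
  refine contMDiffWithinAt_iff_target.2 ⟨?_, h⟩
  exact (Topology.IsInducing.subtypeVal.continuousWithinAt_iff).2 h.continuousWithinAt

theorem contMDiffAt_cover_iff {n : WithTop ℕ∞} {f : N → cover} {x : N} :
    ContMDiffAt J 𝓘(ℝ, R4) n f x ↔ ContMDiffAt J 𝓘(ℝ, R4) n (fun y ↦ (f y : R4)) x :=
  contMDiffWithinAt_cover_iff

end Cover

theorem contMDiff_proj {n : WithTop ℕ∞} : ContMDiff 𝓘(ℝ, R4) 𝓘(ℝ, R4) n proj := by
  intro x
  obtain ⟨g, hg⟩ := exists_smul_eq_rep x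
  refine contMDiffAt_iff_target.2 ⟨continuous_proj.continuousAt, ?_⟩
  refine ContMDiffAt.congr_of_eventuallyEq (f := fun y : cover ↦ linAct g y) ?_
    (eventually_chartAt_proj_self hg)
  exact (linAct g).contDiff.contMDiff.contMDiffAt.comp x contMDiff_coe_cover.contMDiffAt

/-- In the chart at `q`, a continuous local section of π is the chart map followed by a fixed matrix
`g⁻¹`. -/
theorem contMDiffAt_of_proj_comp_eq_id {s : quotientM → cover} {q : quotientM}
    (hs : ContinuousAt s q) (h : ∀ᶠ p in 𝓝 q, proj (s p) = p) :
    ContMDiffAt 𝓘(ℝ, R4) 𝓘(ℝ, R4) ∞ s q := by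
  obtain ⟨g, hg⟩ := exists_smul_eq_rep (s q)
  rw [contMDiffAt_cover_iff]
  have hq : proj (s q) = q := h.self_of_nhds
  have h1 : ContMDiffAt 𝓘(ℝ, R4) 𝓘(ℝ, R4) ∞ (fun p ↦ linAct g⁻¹ (chartAt R4 q p)) q :=
    (linAct g⁻¹).contDiff.contMDiff.contMDiffAt.comp q
      (contMDiffOn_chart.contMDiffAt (chart_source_mem_nhds R4 q))
  refine h1.congr_of_eventuallyEq ?_
  have h2 := hs (eventually_chartAt_proj_self hg)
  filter_upwards [h2, h] with p hp1 hp2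
  have hp1 : chartAt R4 (proj (s q)) (proj (s p)) = linAct g (s p) := hp1
  rw [hq, hp2] at hp1
  rw [hp1, linAct_inv_linAct]

theorem isLocalDiffeomorph_proj : IsLocalDiffeomorph 𝓘(ℝ, R4) 𝓘(ℝ, R4) ∞ proj := by
  intro x
  set e := isLocalHomeomorph_proj.localInverseAt (x := x) with he
  have hsymm : e.symm = proj := isLocalHomeomorph_proj.localInverseAt_symm x
  refine ⟨{ toPartialEquiv := e.symm.toPartialEquiv
            open_source := e.open_target
            open_target := e.open_source
            contMDiffOn_toFun := ?_
            contMDiffOn_invFun := ?_ }, ?_, ?_⟩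
  · change ContMDiffOn _ _ _ e.symm _
    rw [hsymm]; exact contMDiff_proj.contMDiffOn
  · intro q hq
    refine (contMDiffAt_of_proj_comp_eq_id (e.continuousAt hq) ?_).contMDiffWithinAt
    filter_upwards [e.open_source.mem_nhds hq] with p hp
    exact isLocalHomeomorph_proj.apply_localInverseAt_of_mem hp
  · exact isLocalHomeomorph_proj.self_mem_localInverseAt_target
  · intro y _
    exact (congrFun hsymm y).symm

/-! ### The differential of the projection in preferred charts -/

theorem hasMFDerivAt_coe_cover (x : cover) :
    HasMFDerivAt 𝓘(ℝ, R4) 𝓘(ℝ, R4) (Subtype.val : cover → R4) x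
      (ContinuousLinearMap.id ℝ R4) := by
  refine ⟨continuous_subtype_val.continuousAt, ?_⟩
  refine HasFDerivAt.hasFDerivWithinAt ?_
  refine (hasFDerivAt_id (𝕜 := ℝ) (x : R4)).congr_of_eventuallyEq ?_
  exact TopologicalSpace.Opens.chartAt_subtype_val_symm_eventuallyEq (H := R4) cover (x := x) |>.symm

theorem hasMFDerivAt_proj {x : cover} {g : groupG} (hg : g • x = rep (proj x)) :
    HasMFDerivAt 𝓘(ℝ, R4) 𝓘(ℝ, R4) proj x (linAct g) := by
  refine ⟨continuous_proj.continuousAt, ?_⟩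
  refine HasFDerivAt.hasFDerivWithinAt ?_
  refine (linAct g).hasFDerivAt.congr_of_eventuallyEq ?_
  have hx : (x : R4) ∈ (chartAt R4 x).target := (chartAt R4 x).map_source (mem_chart_source R4 x)
  have hc : Filter.Tendsto (chartAt R4 x).symm (𝓝 (x : R4)) (𝓝 x) := by
    have := (chartAt R4 x).symm.continuousAt hx
    rwa [ContinuousAt, show (chartAt R4 x).symm (x : R4) = x from
      (chartAt R4 x).left_inv (mem_chart_source R4 x)] at this
  filter_upwards [hc (eventually_chartAt_proj_self hg), (chartAt R4 x).open_target.mem_nhds hx]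
    with z hz hz1
  have hz : chartAt R4 (proj x) (proj ((chartAt R4 x).symm z)) =
    linAct g ((chartAt R4 x).symm z : cover) := hz
  rw [chartAt_cover_symm hz1] at hz
  exact hz

/-- The element of `{I, G}` carrying `x` to the point used for the chart at `proj x`. -/
def deck (x : cover) : groupG := (exists_smul_eq_rep x).choose

theorem deck_smul (x : cover) : deck x • x = rep (proj x) := (exists_smul_eq_rep x).choose_spec

/-- Both sides carry `g • x` to the chosen lift, and the action is free. -/
theorem deck_smul_eq (g : groupG) (x : cover) : deck (g • x) = deck x * g⁻¹ := by
  refine IsCancelSMul.right_cancel _ _ (g • x) ?_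
  rw [deck_smul, proj_smul, mul_smul, inv_smul_smul, deck_smul]

theorem mfderiv_proj (x : cover) : mfderiv 𝓘(ℝ, R4) 𝓘(ℝ, R4) proj x = linAct (deck x) :=
  (hasMFDerivAt_proj (deck_smul x)).mfderiv

theorem mdifferentiableAt_proj (x : cover) : MDifferentiableAt 𝓘(ℝ, R4) 𝓘(ℝ, R4) proj x :=
  (hasMFDerivAt_proj (deck_smul x)).mdifferentiableAt

theorem isInvertible_mfderiv_proj (x : cover) :
    (mfderiv 𝓘(ℝ, R4) 𝓘(ℝ, R4) proj x).IsInvertible := by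
  rw [mfderiv_proj]
  exact ⟨linActEquiv (deck x), rfl⟩

theorem mpullback_proj (Y : Π q : quotientM, TangentSpace 𝓘(ℝ, R4) q) (x : cover) :
    VectorField.mpullback 𝓘(ℝ, R4) 𝓘(ℝ, R4) proj Y x = linAct (deck x)⁻¹ (Y (proj x)) := by
  rw [VectorField.mpullback_apply, mfderiv_proj]
  change (linActEquiv (deck x) : R4 →L[ℝ] R4).inverse _ = _
  rw [ContinuousLinearMap.inverse_equiv]
  rfl

theorem mfderiv_proj_mpullback (Y : Π q : quotientM, TangentSpace 𝓘(ℝ, R4) q) (x : cover) :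
    mfderiv 𝓘(ℝ, R4) 𝓘(ℝ, R4) proj x (VectorField.mpullback 𝓘(ℝ, R4) 𝓘(ℝ, R4) proj Y x) =
      Y (proj x) := by
  rw [mpullback_proj, mfderiv_proj]
  exact linAct_linAct_inv _ _

theorem mpullback_proj_smul (Y : Π q : quotientM, TangentSpace 𝓘(ℝ, R4) q) (g : groupG)
    (x : cover) : VectorField.mpullback 𝓘(ℝ, R4) 𝓘(ℝ, R4) proj Y (g • x) =
      linAct g (VectorField.mpullback 𝓘(ℝ, R4) 𝓘(ℝ, R4) proj Y x) := by
  have h : ∀ Z : quotientM → R4, linAct (deck (g • x))⁻¹ (Z (proj (g • x))) =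
      linAct g (linAct (deck x)⁻¹ (Z (proj x))) := by
    intro Z
    rw [deck_smul_eq, proj_smul, mul_inv_rev, inv_inv, linAct_mul]
  rw [mpullback_proj, mpullback_proj]
  exact h Y

/-- In the trivialization at `proj x`, the differential of the projection at points near `x` is an
element of `{I, G}`. -/
theorem eventually_trivializationAt_mfderiv_proj (x : cover) :
    ∀ᶠ y in 𝓝 x, ∀ w : TangentSpace 𝓘(ℝ, R4) y,
      (trivializationAt R4 (TangentSpace 𝓘(ℝ, R4) : quotientM → Type _) (proj x)
        ⟨proj y, mfderiv 𝓘(ℝ, R4) 𝓘(ℝ, R4) proj y w⟩).2 = linAct (deck x) w := by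
  filter_upwards [(eventually_chartAt_proj_self (deck_smul x)).eventually_nhds,
    continuous_proj.continuousAt (chart_source_mem_nhds R4 (proj x))] with y hy hy1 w
  have hy1 : proj y ∈ (chartAt R4 (proj x)).source := hy1
  have h1 := TangentBundle.continuousLinearMapAt_trivializationAt (I := 𝓘(ℝ, R4)) hy1
  have hb : proj y ∈ (trivializationAt R4 (TangentSpace 𝓘(ℝ, R4) : quotientM → Type _)
    (proj x)).baseSet := by rwa [TangentBundle.trivializationAt_baseSet]
  have h2 := congrArg (fun L ↦ L (mfderiv 𝓘(ℝ, R4) 𝓘(ℝ, R4) proj y w)) h1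
  have h3 : (trivializationAt R4 (TangentSpace 𝓘(ℝ, R4) : quotientM → Type _) (proj x)
      ⟨proj y, mfderiv 𝓘(ℝ, R4) 𝓘(ℝ, R4) proj y w⟩).2 =
      Trivialization.continuousLinearMapAt ℝ (trivializationAt R4
        (TangentSpace 𝓘(ℝ, R4) : quotientM → Type _) (proj x)) (proj y)
        (mfderiv 𝓘(ℝ, R4) 𝓘(ℝ, R4) proj y w) := by
    rw [Trivialization.continuousLinearMapAt_apply, Trivialization.coe_linearMapAt_of_mem _ hb]
  rw [h3]
  refine h2.trans ?_
  have hd : MDifferentiableAt 𝓘(ℝ, R4) 𝓘(ℝ, R4) (extChartAt 𝓘(ℝ, R4) (proj x)) (proj y) :=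
    mdifferentiableAt_extChartAt hy1
  have h4 := mfderiv_comp y hd (mdifferentiableAt_proj y)
  have h5 : HasMFDerivAt 𝓘(ℝ, R4) 𝓘(ℝ, R4) (extChartAt 𝓘(ℝ, R4) (proj x) ∘ proj) y
      ((linAct (deck x)).comp (ContinuousLinearMap.id ℝ R4)) := by
    refine HasMFDerivAt.congr_of_eventuallyEq
      (HasMFDerivAt.comp y (linAct (deck x)).hasFDerivAt.hasMFDerivAt
        (hasMFDerivAt_coe_cover y)) ?_
    filter_upwards [hy] with z hz
    exact hz
  rw [h5.mfderiv] at h4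
  exact (congrArg (fun L ↦ L w) h4).symm

theorem chartCoord_mfderiv_proj (x : cover) (w : TangentSpace 𝓘(ℝ, R4) x) :
    chartCoord (proj x) (proj x) (mfderiv 𝓘(ℝ, R4) 𝓘(ℝ, R4) proj x w) = linAct (deck x) w :=
  (eventually_trivializationAt_mfderiv_proj x).self_of_nhds w

theorem mem_baseSet_trivializationAt_proj (x : cover) : ∀ᶠ y in 𝓝 x, proj y ∈
    (trivializationAt R4 (TangentSpace 𝓘(ℝ, R4) : quotientM → Type _) (proj x)).baseSet :=
  continuous_proj.continuousAt ((trivializationAt R4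
    (TangentSpace 𝓘(ℝ, R4) : quotientM → Type _) (proj x)).open_baseSet.mem_nhds
      (FiberBundle.mem_baseSet_trivializationAt' (proj x)))

theorem eventually_trivializationAt_symm_proj (x : cover) :
    ∀ᶠ y in 𝓝 x, ∀ u : R4,
      (trivializationAt R4 (TangentSpace 𝓘(ℝ, R4) : quotientM → Type _) (proj x)).symm (proj y) u =
        mfderiv 𝓘(ℝ, R4) 𝓘(ℝ, R4) proj y (linAct (deck x)⁻¹ u : R4) := by
  filter_upwards [eventually_trivializationAt_mfderiv_proj x,
    mem_baseSet_trivializationAt_proj x] with y hy hb u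
  have h := hy (linAct (deck x)⁻¹ u : R4)
  rw [linAct_linAct_inv] at h
  exact (congrArg ((trivializationAt R4 (TangentSpace 𝓘(ℝ, R4) : quotientM → Type _)
    (proj x)).symm (proj y)) h.symm).trans (Trivialization.symm_apply_apply_mk _ hb _)

/-- A map on `M` is smooth if its composition with the projection is. -/
theorem contMDiffAt_of_comp_proj {E' H' N : Type*} [NormedAddCommGroup E'] [NormedSpace ℝ E']
    [TopologicalSpace H'] {J : ModelWithCorners ℝ E' H'} [TopologicalSpace N] [ChartedSpace H' N]
    {f : quotientM → N} {x : cover} (h : ContMDiffAt 𝓘(ℝ, R4) J ∞ (fun y ↦ f (proj y)) x) :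
    ContMDiffAt 𝓘(ℝ, R4) J ∞ f (proj x) := by
  set e := isLocalHomeomorph_proj.localInverseAt (x := x) with he
  have hx : proj x ∈ e.source := isLocalHomeomorph_proj.apply_self_mem_localInverseAt_source
  have hx' : e (proj x) = x := isLocalHomeomorph_proj.localInverseAt_apply_self
  have hp : ∀ᶠ p in 𝓝 (proj x), proj (e p) = p := by
    filter_upwards [e.open_source.mem_nhds hx] with p hp
    exact isLocalHomeomorph_proj.apply_localInverseAt_of_mem hp
  have hs := contMDiffAt_of_proj_comp_eq_id (e.continuousAt hx) hp
  have h' : ContMDiffAt 𝓘(ℝ, R4) J ∞ (fun y ↦ f (proj y)) (e (proj x)) := by rwa [hx']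
  refine (h'.comp (proj x) hs).congr_of_eventuallyEq ?_
  filter_upwards [hp] with p hp
  simp only [Function.comp_apply, hp]

/-- Near `x` the trivialization at `proj x` turns dπ into the single matrix `deck x`, even though
`deck y` may vary. An endomorphism field on M is thus read on the cover up to a constant
conjugation. -/
theorem inCoordinates_proj (x : cover) :
    ∀ᶠ y in 𝓝 x, ∀ (φ : TangentSpace 𝓘(ℝ, R4) (proj y) →L[ℝ] TangentSpace 𝓘(ℝ, R4) (proj y))
      (ψ : R4 →L[ℝ] R4), (∀ w : R4, φ (mfderiv 𝓘(ℝ, R4) 𝓘(ℝ, R4) proj y w) =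
        mfderiv 𝓘(ℝ, R4) 𝓘(ℝ, R4) proj y (ψ w)) →
      ContinuousLinearMap.inCoordinates R4 (TangentSpace 𝓘(ℝ, R4) : quotientM → Type _) R4
        (TangentSpace 𝓘(ℝ, R4) : quotientM → Type _) (proj x) (proj y) (proj x) (proj y) φ =
        (linAct (deck x)).comp (ψ.comp (linAct (deck x)⁻¹)) := by
  filter_upwards [eventually_trivializationAt_mfderiv_proj x,
    eventually_trivializationAt_symm_proj x, mem_baseSet_trivializationAt_proj x]
    with y h1 h2 hb φ ψ h
  ext1 u
  rw [ContinuousLinearMap.inCoordinates, ContinuousLinearMap.comp_apply,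
    ContinuousLinearMap.comp_apply, Trivialization.symmL_apply,
    Trivialization.continuousLinearMapAt_apply, Trivialization.coe_linearMapAt_of_mem _ hb]
  have h3 := h2 u
  have h4 := h (linAct (deck x)⁻¹ u)
  refine Eq.trans ?_ (h1 (ψ (linAct (deck x)⁻¹ u)))
  · rw [← h4, ← h3]
  · exact hb

/-! ### Equivariance of θ and descent of the connection -/

theorem thetaBilin_apply (x w v : R4) : thetaBilin x w v =
    !₂[formAlpha x v * w 1 + formBeta x v * w 3, -(formAlpha x v * w 0) - formBeta x v * w 2,
      -(formBeta x v * w 1) + formAlpha x v * w 3, formBeta x v * w 0 - formAlpha x v * w 2] := by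
  change Matrix.toEuclideanLin (formTheta x v) w = _
  ext i
  fin_cases i <;> simp [formTheta, Matrix.toLpLin_apply, dotProduct, Fin.sum_univ_four] <;> ring

/-- The element `G` of the group `{I, G}`. -/
def genG : groupG := ⟨unitG, Or.inr rfl⟩

theorem eq_one_or_genG (g : groupG) : g = 1 ∨ g = genG := by
  obtain ⟨g, rfl | rfl⟩ := g
  · exact Or.inl rfl
  · exact Or.inr rfl

theorem linAct_genG (x : R4) : linAct genG x =
    !₂[√2 * x 0 + x 3, -(√2 * x 1) + x 2, -x 1 + √2 * x 2, -x 0 - √2 * x 3] := by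
  change Matrix.toEuclideanLin matG x = _
  ext i
  fin_cases i <;> simp [matG, Matrix.toLpLin_apply, dotProduct, Fin.sum_univ_four]
  ring

theorem formAlpha_genG (x v : R4) :
    formAlpha (linAct genG x) (linAct genG v) = -formAlpha x v := by
  have h : √2 * √2 = 2 := by norm_num
  simp only [linAct_genG, formAlpha]
  simp
  linear_combination (-(x 0 * v 3) + x 3 * v 0) * h

theorem formBeta_genG (x v : R4) :
    formBeta (linAct genG x) (linAct genG v) = -formBeta x v := by
  have h : √2 * √2 = 2 := by norm_num
  simp only [linAct_genG, formBeta]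
  simp
  linear_combination (-(x 1 * v 2) + x 2 * v 1) * h

/-- For G two signs cancel: α and β change sign under G, and G anticommutes with the matrices that
they multiply in θ. -/
theorem thetaBilin_linAct (g : groupG) (x w v : R4) :
    thetaBilin (linAct g x) (linAct g w) (linAct g v) = linAct g (thetaBilin x w v) := by
  obtain rfl | rfl := eq_one_or_genG g
  · simp only [linAct_one]
  · simp only [thetaBilin_apply, formAlpha_genG, formBeta_genG]
    simp only [linAct_genG]
    ext i
    fin_cases i <;> simp <;> ring

theorem coverConnection_apply (Z : Π y : cover, TangentSpace 𝓘(ℝ, R4) y) (x : cover)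
    (v : TangentSpace 𝓘(ℝ, R4) x) : coverConnection Z x v =
      mvfderiv 𝓘(ℝ, R4) (components Z) x v + thetaBilin x (Z x) v := rfl

theorem hasMFDerivAt_smul_cover (g : groupG) (x : cover) :
    HasMFDerivAt 𝓘(ℝ, R4) 𝓘(ℝ, R4) (fun y : cover ↦ g • y) x (linAct g) := by
  have h1 : ContMDiffAt 𝓘(ℝ, R4) 𝓘(ℝ, R4) 1 (fun y : cover ↦ g • y) x := by
    rw [contMDiffAt_cover_iff]
    exact (linAct g).contDiff.contMDiff.contMDiffAt.comp x contMDiff_coe_cover.contMDiffAt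
  have h2 := (h1.mdifferentiableAt one_ne_zero).hasMFDerivAt
  have h3 := (hasMFDerivAt_coe_cover (g • x)).comp x h2
  have h4 := HasMFDerivAt.comp x ((linAct g).hasFDerivAt (x := (x : R4))).hasMFDerivAt
    (hasMFDerivAt_coe_cover x)
  have h5 := hasMFDerivAt_unique h3 h4
  have h6 : mfderiv 𝓘(ℝ, R4) 𝓘(ℝ, R4) (fun y : cover ↦ g • y) x = linAct g := h5
  rw [← h6]
  exact h2

/-- The connection `∇'` preserves vector fields that are equivariant under `{I, G}`. -/
theorem coverConnection_smul {Z : Π y : cover, TangentSpace 𝓘(ℝ, R4) y} (g : groupG) {x : cover}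
    (hZ : ∀ y : cover, components Z (g • y) = linAct g (components Z y))
    (h1 : MDifferentiableAt 𝓘(ℝ, R4) 𝓘(ℝ, R4) (components Z) x)
    (h2 : MDifferentiableAt 𝓘(ℝ, R4) 𝓘(ℝ, R4) (components Z) (g • x)) (v : R4) :
    (coverConnection Z (g • x) (linAct g v : R4) : R4) =
      linAct g (coverConnection Z x v : R4) := by
  have h3 := h2.hasMFDerivAt.comp x (hasMFDerivAt_smul_cover g x)
  have h4 := HasMFDerivAt.comp x ((linAct g).hasFDerivAt (x := components Z x)).hasMFDerivAt
    h1.hasMFDerivAt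
  have h5 : components Z ∘ (fun y : cover ↦ g • y) = linAct g ∘ components Z := funext hZ
  rw [h5] at h3
  have h6 := congrArg (fun L ↦ L v) (hasMFDerivAt_unique h3 h4)
  have h7 : (mvfderiv 𝓘(ℝ, R4) (components Z) (g • x) (linAct g v : R4) : R4) =
    linAct g (mvfderiv 𝓘(ℝ, R4) (components Z) x v : R4) := h6
  have h8 : thetaBilin ((g • x : cover) : R4) (components Z (g • x)) (linAct g v) =
      linAct g (thetaBilin (x : R4) (components Z x) v) := by
    rw [hZ, coe_smul_eq_linAct, thetaBilin_linAct]
  exact (congrArg₂ (fun a b : R4 ↦ a + b) h7 h8).trans (map_add (linAct g) _ _).symm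

theorem mdifferentiableAt_mpullback {Y : Π q : quotientM, TangentSpace 𝓘(ℝ, R4) q} {x : cover}
    (hY : MDifferentiableAt 𝓘(ℝ, R4) 𝓘(ℝ, R4).tangent
      (fun y ↦ (⟨y, Y y⟩ : TangentBundle 𝓘(ℝ, R4) quotientM)) (proj x)) :
    MDifferentiableAt 𝓘(ℝ, R4) 𝓘(ℝ, R4).tangent
      (fun y ↦ (⟨y, VectorField.mpullback 𝓘(ℝ, R4) 𝓘(ℝ, R4) proj Y y⟩ :
        TangentBundle 𝓘(ℝ, R4) cover)) x :=
  hY.mpullback_vectorField (n := ∞) contMDiff_proj.contMDiffAt (isInvertible_mfderiv_proj x)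
    (by norm_cast)

/-- The value at `q` of the connection on `M`, computed at the point over `q` used for the chart
at `q`. -/
def quotientConnectionFun (Y : Π q : quotientM, TangentSpace 𝓘(ℝ, R4) q) (q : quotientM) :
    TangentSpace 𝓘(ℝ, R4) q →L[ℝ] TangentSpace 𝓘(ℝ, R4) q :=
  coverConnection (VectorField.mpullback 𝓘(ℝ, R4) 𝓘(ℝ, R4) proj Y) (rep q)

theorem quotientConnectionFun_proj {Y : Π q : quotientM, TangentSpace 𝓘(ℝ, R4) q} {x : cover}
    (hY : MDifferentiableAt 𝓘(ℝ, R4) 𝓘(ℝ, R4).tangent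
      (fun y ↦ (⟨y, Y y⟩ : TangentBundle 𝓘(ℝ, R4) quotientM)) (proj x))
    (v : TangentSpace 𝓘(ℝ, R4) x) :
    quotientConnectionFun Y (proj x) (mfderiv 𝓘(ℝ, R4) 𝓘(ℝ, R4) proj x v) =
      mfderiv 𝓘(ℝ, R4) 𝓘(ℝ, R4) proj x
        (coverConnection (VectorField.mpullback 𝓘(ℝ, R4) 𝓘(ℝ, R4) proj Y) x v) := by
  have hx := mdifferentiableAt_components (mdifferentiableAt_mpullback hY)
  have hY' : MDifferentiableAt 𝓘(ℝ, R4) 𝓘(ℝ, R4).tangent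
      (fun y ↦ (⟨y, Y y⟩ : TangentBundle 𝓘(ℝ, R4) quotientM)) (proj (deck x • x)) := by
    rwa [proj_smul]
  have hx' := mdifferentiableAt_components (mdifferentiableAt_mpullback hY')
  have h := coverConnection_smul
    (Z := VectorField.mpullback 𝓘(ℝ, R4) 𝓘(ℝ, R4) proj Y) (deck x) (mpullback_proj_smul Y (deck x)) hx hx' v
  rw [mfderiv_proj]
  refine Eq.trans ?_ h
  -- A general `z` makes the substitution possible; rewriting the base point directly would change
  -- the types of the tangent spaces.
  have h2 : ∀ z : cover, z = rep (proj x) →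
      (quotientConnectionFun Y (proj x) (linAct (deck x) v : R4) : R4) =
      coverConnection (VectorField.mpullback 𝓘(ℝ, R4) 𝓘(ℝ, R4) proj Y) z
        (linAct (deck x) v : R4) := by
    rintro z rfl; rfl
  exact h2 _ (deck_smul x)

theorem ext_mfderiv_proj {F : Type*} [NormedAddCommGroup F] [NormedSpace ℝ F] {x : cover}
    {φ ψ : TangentSpace 𝓘(ℝ, R4) (proj x) →L[ℝ] F}
    (h : ∀ v : TangentSpace 𝓘(ℝ, R4) x, φ (mfderiv 𝓘(ℝ, R4) 𝓘(ℝ, R4) proj x v) =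
      ψ (mfderiv 𝓘(ℝ, R4) 𝓘(ℝ, R4) proj x v)) : φ = ψ := by
  ext v
  have h1 := h (linAct (deck x)⁻¹ v : R4)
  have h2 : (mfderiv 𝓘(ℝ, R4) 𝓘(ℝ, R4) proj x (linAct (deck x)⁻¹ v : R4)) = v := by
    rw [mfderiv_proj]; exact linAct_linAct_inv _ _
  rwa [h2] at h1

theorem mdifferentiableAt_comp_proj {f : quotientM → ℝ} {x : cover}
    (hf : MDifferentiableAt 𝓘(ℝ, R4) 𝓘(ℝ, ℝ) f (proj x)) :
    MDifferentiableAt 𝓘(ℝ, R4) 𝓘(ℝ, ℝ) (f ∘ proj) x :=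
  hf.comp x (mdifferentiableAt_proj x)

theorem quotientConnectionFun_ext {x : cover} {φ ψ : TangentSpace 𝓘(ℝ, R4) (proj x) →L[ℝ]
      TangentSpace 𝓘(ℝ, R4) (proj x)}
    (h : ∀ v : TangentSpace 𝓘(ℝ, R4) x, φ (mfderiv 𝓘(ℝ, R4) 𝓘(ℝ, R4) proj x v) =
      ψ (mfderiv 𝓘(ℝ, R4) 𝓘(ℝ, R4) proj x v)) : φ = ψ :=
  ext_mfderiv_proj (F := R4) h

/-- The connection on `M` obtained from `∇'`. -/
def quotientConnection : LinearConnection 𝓘(ℝ, R4) quotientM where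
  toFun := quotientConnectionFun
  isCovariantDerivativeOnUniv :=
    { add := by
        intro Y Z q hY hZ _
        obtain ⟨x, rfl⟩ := proj_surjective q
        refine quotientConnectionFun_ext fun v ↦ ?_
        have hYZ := mdifferentiableAt_add_section hY hZ
        rw [add_apply, quotientConnectionFun_proj hY,
          quotientConnectionFun_proj hZ]
        refine (quotientConnectionFun_proj hYZ v).trans ?_
        rw [← map_add]
        congr 1
        rw [VectorField.mpullback_add, coverConnection.isCovariantDerivativeOnUniv.add
          (mdifferentiableAt_mpullback hY) (mdifferentiableAt_mpullback hZ)]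
        rfl
      leibniz := by
        intro Y f q hY hf _
        obtain ⟨x, rfl⟩ := proj_surjective q
        refine quotientConnectionFun_ext fun v ↦ ?_
        have hfY := MDifferentiableAt.smul_section hf hY
        refine (quotientConnectionFun_proj hfY v).trans ?_
        rw [VectorField.mpullback_smul, coverConnection.isCovariantDerivativeOnUniv.leibniz
          (mdifferentiableAt_mpullback hY) (mdifferentiableAt_comp_proj hf)]
        simp only [add_apply, smul_apply,
          ContinuousLinearMap.smulRight_apply, map_add, map_smul]
        rw [quotientConnectionFun_proj hY, mfderiv_proj_mpullback,
          mvfderiv_comp_apply _ hf (mdifferentiableAt_proj x)]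
        rfl }

theorem projectsTo_quotientConnection : ProjectsTo proj coverConnection quotientConnection :=
  fun _ _ hY v ↦ (quotientConnectionFun_proj hY v).symm

/-! ### Smoothness of the descended connection -/

theorem contDiff_thetaBilin : ContDiff ℝ ∞ thetaBilin := by
  rw [contDiff_clm_apply_iff]
  intro w
  rw [contDiff_clm_apply_iff]
  intro v
  simp only [thetaBilin_apply, formAlpha, formBeta]
  rw [contDiff_euclidean]
  intro i
  fin_cases i <;> simp <;> fun_prop

theorem contMDiffAt_mvfderiv_cover {F : Type*} [NormedAddCommGroup F] [NormedSpace ℝ F]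
    {Z : cover → F} (hZ : ContMDiff 𝓘(ℝ, R4) 𝓘(ℝ, F) ∞ Z) (x : cover) :
    ContMDiffAt (M' := R4 →L[ℝ] F) 𝓘(ℝ, R4) 𝓘(ℝ, R4 →L[ℝ] F) ∞
      (fun y : cover ↦ mvfderiv 𝓘(ℝ, R4) Z y) x := by
  -- Extension by zero reduces the claim to `fderiv` on ℝ⁴. The values on E play no role because the
  -- cover is open.
  set Zt : R4 → F := Function.extend Subtype.val Z 0 with hZt
  have hext : ∀ y : cover, Zt y = Z y := fun y ↦ Subtype.val_injective.extend_apply _ _ _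
  have hsm : ∀ y : cover, ContDiffAt ℝ ∞ Zt y := by
    intro y
    rw [← contMDiffAt_iff_contDiffAt, ← contMDiffAt_subtype_iff]
    simp only [hext]
    exact hZ y
  have hder : ∀ y : cover, (mvfderiv 𝓘(ℝ, R4) Z y : R4 →L[ℝ] F) = fderiv ℝ Zt y := by
    intro y
    have h1 := HasMFDerivAt.comp y
      ((hsm y).differentiableAt (by simp)).hasFDerivAt.hasMFDerivAt (hasMFDerivAt_coe_cover y)
    have h2 : Zt ∘ (Subtype.val : cover → R4) = Z := funext hext
    rw [h2] at h1
    exact congrArg (fun L : R4 →L[ℝ] F ↦ L) h1.mfderiv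
  have hder' : (fun y : cover ↦ (mvfderiv 𝓘(ℝ, R4) Z y : R4 →L[ℝ] F)) =
    fun y : cover ↦ fderiv ℝ Zt y := funext hder
  rw [hder']
  have h3 : ContDiffAt ℝ ∞ (fderiv ℝ Zt) x := (hsm x).fderiv_right (by rfl)
  exact h3.contMDiffAt.comp x contMDiff_coe_cover.contMDiffAt

theorem contMDiff_components {Z : Π y : cover, TangentSpace 𝓘(ℝ, R4) y}
    (hZ : ContMDiff 𝓘(ℝ, R4) 𝓘(ℝ, R4).tangent ∞
      (fun y ↦ (⟨y, Z y⟩ : TangentBundle 𝓘(ℝ, R4) cover))) :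
    ContMDiff 𝓘(ℝ, R4) 𝓘(ℝ, R4) ∞ (components Z) := by
  intro x
  have h := (contMDiffAt_section _).1 (hZ x)
  have h2 : (fun y ↦ (trivializationAt R4 (TangentSpace 𝓘(ℝ, R4) : cover → Type _) x
      ⟨y, Z y⟩).2) = components Z := funext fun y ↦ trivializationAt_cover x ⟨y, Z y⟩
  rwa [h2] at h

/-- Near `proj x` the coordinate expression of ∇σ is dZ + θZ conjugated by the constant matrix `deck
x`, where Z is the pullback of σ. -/
theorem contMDiff_quotientConnection :
    CovariantDerivative.ContMDiffCovariantDerivative quotientConnection ∞ := by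
  refine ⟨⟨fun {σ} hσ ↦ ?_⟩⟩
  intro q _
  obtain ⟨x, rfl⟩ := proj_surjective q
  refine ContMDiffAt.contMDiffWithinAt ?_
  have hσ' : ContMDiff 𝓘(ℝ, R4) 𝓘(ℝ, R4).tangent ∞
      (fun q ↦ (⟨q, σ q⟩ : TangentBundle 𝓘(ℝ, R4) quotientM)) :=
    contMDiffOn_univ.1 (hσ.of_le (by rfl))
  have hZ := contMDiff_components (hσ'.mpullback_vectorField (n := ∞) contMDiff_proj
    isInvertible_mfderiv_proj (by rfl))
  rw [contMDiffAt_hom_bundle]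
  refine ⟨contMDiffAt_id, contMDiffAt_of_comp_proj ?_⟩
  set Z := VectorField.mpullback 𝓘(ℝ, R4) 𝓘(ℝ, R4) proj σ with hZdef
  have h1 : ContMDiffAt (M' := R4 →L[ℝ] R4) 𝓘(ℝ, R4) 𝓘(ℝ, R4 →L[ℝ] R4) ∞
      (fun y : cover ↦ coverConnection Z y) x := by
    have h2 : ContMDiffAt 𝓘(ℝ, R4) 𝓘(ℝ, R4 →L[ℝ] R4) ∞
        (fun y : cover ↦ thetaBilin y (components Z y)) x :=
      (contDiff_thetaBilin.contMDiff.contMDiffAt.comp x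
        contMDiff_coe_cover.contMDiffAt).clm_apply (hZ x)
    exact (contMDiffAt_mvfderiv_cover hZ x).add h2
  have h3 : ContMDiffAt 𝓘(ℝ, R4) 𝓘(ℝ, R4 →L[ℝ] R4) ∞
      (fun y : cover ↦ (linAct (deck x)).comp ((coverConnection Z y : R4 →L[ℝ] R4).comp
        (linAct (deck x)⁻¹))) x :=
    contMDiffAt_const.clm_comp (h1.clm_comp contMDiffAt_const)
  refine h3.congr_of_eventuallyEq ?_
  filter_upwards [inCoordinates_proj x] with y hy
  exact hy _ _ fun w ↦ quotientConnectionFun_proj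
    ((hσ'.mdifferentiable (by simp)) (proj y)) w

/-! ### Invariant forms and the parallel metrics on M -/

/-- The bilinear form `∑ C i j dxⁱ ⊗ dxʲ` on `ℝ⁴`. -/
def constFormCLM (C : Matrix (Fin 4) (Fin 4) ℝ) : R4 →L[ℝ] R4 →L[ℝ] ℝ :=
  (LinearMap.mk₂ ℝ (constForm C)
    (fun v v' w ↦ by
      simp only [constForm, ← Finset.sum_add_distrib]
      refine Finset.sum_congr rfl fun i _ ↦ Finset.sum_congr rfl fun j _ ↦ ?_
      rw [PiLp.add_apply]; ring)
    (fun c v w ↦ by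
      simp only [constForm, smul_eq_mul, Finset.mul_sum]
      refine Finset.sum_congr rfl fun i _ ↦ Finset.sum_congr rfl fun j _ ↦ ?_
      rw [PiLp.smul_apply, smul_eq_mul]; ring)
    (fun v w w' ↦ by
      simp only [constForm, ← Finset.sum_add_distrib]
      refine Finset.sum_congr rfl fun i _ ↦ Finset.sum_congr rfl fun j _ ↦ ?_
      rw [PiLp.add_apply]; ring)
    (fun c v w ↦ by
      simp only [constForm, smul_eq_mul, Finset.mul_sum]
      refine Finset.sum_congr rfl fun i _ ↦ Finset.sum_congr rfl fun j _ ↦ ?_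
      rw [PiLp.smul_apply, smul_eq_mul]; ring)).toContinuousBilinearMap

/-- The constant-coefficient form with matrix `C` is a `G`-invariant scalar product for which the
forms `θ(v)` are skew. -/
structure IsInvariantForm (C : Matrix (Fin 4) (Fin 4) ℝ) : Prop where
  symm (v w : R4) : constForm C v w = constForm C w v
  nondegenerate (v : R4) (hv : ∀ w, constForm C v w = 0) : v = 0
  map_genG (v w : R4) : constForm C (linAct genG v) (linAct genG w) = constForm C v w
  skew (x v w u : R4) : constForm C (thetaBilin x w v) u + constForm C w (thetaBilin x u v) = 0

theorem constForm_matK (v w : R4) :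
    constForm matK v w = v 0 * w 0 + v 1 * w 1 - v 2 * w 2 - v 3 * w 3 := by
  simp [constForm, matK, Fin.sum_univ_four]
  ring

theorem constForm_matL (v w : R4) :
    constForm matL v w = v 0 * w 2 + v 1 * w 3 + v 2 * w 0 + v 3 * w 1 := by
  simp [constForm, matL, Fin.sum_univ_four]

theorem isInvariantForm_matK : IsInvariantForm matK where
  symm v w := by simp only [constForm_matK]; ring
  nondegenerate v hv := by
    ext i
    have h := hv (EuclideanSpace.single i 1)
    rw [constForm_matK] at h
    fin_cases i <;> simpa using h
  map_genG v w := by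
    have h : √2 * √2 = 2 := by norm_num
    simp only [constForm_matK, linAct_genG]
    simp
    linear_combination (v 0 * w 0 + v 1 * w 1 - v 2 * w 2 - v 3 * w 3) * h
  skew x v w u := by
    simp only [constForm_matK, thetaBilin_apply]
    simp
    ring

theorem isInvariantForm_matL : IsInvariantForm matL where
  symm v w := by simp only [constForm_matL]; ring
  nondegenerate v hv := by
    ext i
    have h0 := hv (EuclideanSpace.single 0 1)
    have h1 := hv (EuclideanSpace.single 1 1)
    have h2 := hv (EuclideanSpace.single 2 1)
    have h3 := hv (EuclideanSpace.single 3 1)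
    rw [constForm_matL] at h0 h1 h2 h3
    simp at h0 h1 h2 h3
    fin_cases i <;> simp [h0, h1, h2, h3]
  map_genG v w := by
    have h : √2 * √2 = 2 := by norm_num
    simp only [constForm_matL, linAct_genG]
    simp
    linear_combination (v 0 * w 2 + v 1 * w 3 + v 2 * w 0 + v 3 * w 1) * h
  skew x v w u := by
    simp only [constForm_matL, thetaBilin_apply]
    simp
    ring

theorem IsInvariantForm.map_linAct {C : Matrix (Fin 4) (Fin 4) ℝ} (hC : IsInvariantForm C)
    (g : groupG) (v w : R4) : constForm C (linAct g v) (linAct g w) = constForm C v w := by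
  obtain rfl | rfl := eq_one_or_genG g
  · rw [linAct_one, linAct_one]
  · exact hC.map_genG v w

/-- The constant-coefficient form on the tangent spaces of `M`, in the coordinates of the
preferred charts. -/
def quotientForm (C : Matrix (Fin 4) (Fin 4) ℝ) (q : quotientM) :
    TangentSpace 𝓘(ℝ, R4) q →L[ℝ] TangentSpace 𝓘(ℝ, R4) q →L[ℝ] ℝ := constFormCLM C

theorem IsInvariantForm.quotientForm_mfderiv_proj {C : Matrix (Fin 4) (Fin 4) ℝ}
    (hC : IsInvariantForm C) (x : cover) (v w : TangentSpace 𝓘(ℝ, R4) x) :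
    quotientForm C (proj x) (mfderiv 𝓘(ℝ, R4) 𝓘(ℝ, R4) proj x v)
      (mfderiv 𝓘(ℝ, R4) 𝓘(ℝ, R4) proj x w) = constForm C v w := by
  rw [mfderiv_proj]
  exact hC.map_linAct _ _ _

/-- The semi-Riemannian metric on `M` induced by an invariant constant-coefficient form. -/
def quotientMetric {C : Matrix (Fin 4) (Fin 4) ℝ} (hC : IsInvariantForm C) :
    SemiRiemannianMetric 𝓘(ℝ, R4) quotientM where
  form := quotientForm C
  symm _ v w := hC.symm v w
  nondegenerate _ v hv := hC.nondegenerate v hv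
  contMDiff := by
    intro q
    obtain ⟨x, rfl⟩ := proj_surjective q
    rw [contMDiffAt_hom_bundle]
    refine ⟨contMDiffAt_id, contMDiffAt_of_comp_proj ?_⟩
    refine (contMDiffAt_const (c := constFormCLM C)).congr_of_eventuallyEq ?_
    filter_upwards [eventually_trivializationAt_symm_proj x,
      mem_baseSet_trivializationAt_proj x] with y hy hb
    ext v w
    refine (inCoordinates_apply_eq₂ (E₃ := Trivial quotientM ℝ) hb hb (Set.mem_univ _)).trans ?_
    rw [hy, hy]
    rw [Trivialization.coe_linearMapAt_of_mem _ (Set.mem_univ _)]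
    refine (hC.quotientForm_mfderiv_proj y _ _).trans ?_
    exact hC.map_linAct _ v w

theorem mdifferentiableAt_of_comp_proj {f : quotientM → ℝ} {x : cover}
    (h : MDifferentiableAt 𝓘(ℝ, R4) 𝓘(ℝ, ℝ) (fun y ↦ f (proj y)) x) :
    MDifferentiableAt 𝓘(ℝ, R4) 𝓘(ℝ, ℝ) f (proj x) := by
  set e := isLocalHomeomorph_proj.localInverseAt (x := x) with he
  have hx : proj x ∈ e.source := isLocalHomeomorph_proj.apply_self_mem_localInverseAt_source
  have hx' : e (proj x) = x := isLocalHomeomorph_proj.localInverseAt_apply_self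
  have hp : ∀ᶠ p in 𝓝 (proj x), proj (e p) = p := by
    filter_upwards [e.open_source.mem_nhds hx] with p hp
    exact isLocalHomeomorph_proj.apply_localInverseAt_of_mem hp
  have hs := contMDiffAt_of_proj_comp_eq_id (e.continuousAt hx) hp
  have h' : MDifferentiableAt 𝓘(ℝ, R4) 𝓘(ℝ, ℝ) (fun y ↦ f (proj y)) (e (proj x)) := by
    rwa [hx']
  refine (h'.comp (proj x) (hs.mdifferentiableAt (by simp))).congr_of_eventuallyEq ?_
  filter_upwards [hp] with p hp
  simp only [Function.comp_apply, hp]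

theorem hasMFDerivAt_prodMk_cover {F F' : Type*} [NormedAddCommGroup F] [NormedSpace ℝ F]
    [NormedAddCommGroup F'] [NormedSpace ℝ F'] {f : cover → F} {f' : cover → F'} {x : cover}
    {L : R4 →L[ℝ] F} {L' : R4 →L[ℝ] F'} (h : HasMFDerivAt 𝓘(ℝ, R4) 𝓘(ℝ, F) f x L)
    (h' : HasMFDerivAt 𝓘(ℝ, R4) 𝓘(ℝ, F') f' x L') :
    HasMFDerivAt 𝓘(ℝ, R4) 𝓘(ℝ, F × F') (fun y ↦ (f y, f' y)) x (L.prod L') :=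
  ⟨h.1.prodMk h'.1, HasFDerivWithinAt.prodMk h.2 h'.2⟩

/-- On the cover the form has constant coefficients, so the ordinary product rule holds. The two
extra θ terms of the connection cancel by skewness. -/
theorem isParallel_quotientMetric {C : Matrix (Fin 4) (Fin 4) ℝ} (hC : IsInvariantForm C) :
    (quotientMetric hC).IsParallel quotientConnection := by
  intro q Y Z hY hZ v
  obtain ⟨x, rfl⟩ := proj_surjective q
  obtain ⟨v, rfl⟩ : ∃ u : TangentSpace 𝓘(ℝ, R4) x, mfderiv 𝓘(ℝ, R4) 𝓘(ℝ, R4) proj x u = v := by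
    rw [mfderiv_proj]
    exact ⟨linAct (deck x)⁻¹ v, linAct_linAct_inv _ _⟩
  set Y' := VectorField.mpullback 𝓘(ℝ, R4) 𝓘(ℝ, R4) proj Y with hY'
  set Z' := VectorField.mpullback 𝓘(ℝ, R4) 𝓘(ℝ, R4) proj Z with hZ'
  have hYd : MDifferentiableAt 𝓘(ℝ, R4) 𝓘(ℝ, R4) (components Y') x :=
    mdifferentiableAt_components (mdifferentiableAt_mpullback hY)
  have hZd : MDifferentiableAt 𝓘(ℝ, R4) 𝓘(ℝ, R4) (components Z') x :=
    mdifferentiableAt_components (mdifferentiableAt_mpullback hZ)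
  have hf : (fun y ↦ quotientForm C (proj y) (Y (proj y)) (Z (proj y))) =
      fun y ↦ constFormCLM C (components Y' y) (components Z' y) := by
    funext y
    rw [← mfderiv_proj_mpullback Y, ← mfderiv_proj_mpullback Z]
    exact hC.quotientForm_mfderiv_proj y _ _
  have hd := HasMFDerivAt.comp x ((constFormCLM C).isBoundedBilinearMap.hasFDerivAt
    (components Y' x, components Z' x)).hasMFDerivAt
    (hasMFDerivAt_prodMk_cover hYd.hasMFDerivAt hZd.hasMFDerivAt)
  have hd' := hd.congr_of_eventuallyEq
    (f₁ := fun y ↦ quotientForm C (proj y) (Y (proj y)) (Z (proj y)))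
    (Filter.Eventually.of_forall (congrFun hf))
  have h1 := mvfderiv_comp_apply (g := fun q ↦ quotientForm C q (Y q) (Z q)) x
    (mdifferentiableAt_of_comp_proj hd'.mdifferentiableAt) (mdifferentiableAt_proj x) v
  have h2 : mvfderiv 𝓘(ℝ, R4) ((fun q ↦ quotientForm C q (Y q) (Z q)) ∘ proj) x v =
      constForm C (components Y' x) (mvfderiv 𝓘(ℝ, R4) (components Z') x v) +
      constForm C (mvfderiv 𝓘(ℝ, R4) (components Y') x v) (components Z' x) :=
    congrArg (fun L ↦ L v) hd'.mfderiv
  refine h1.symm.trans (h2.trans ?_)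
  have h3 : quotientForm C (proj x) (quotientConnection Y (proj x)
      (mfderiv 𝓘(ℝ, R4) 𝓘(ℝ, R4) proj x v)) (Z (proj x)) =
      constForm C (coverConnection Y' x v) (Z' x) := by
    rw [← projectsTo_quotientConnection x Y hY v, ← mfderiv_proj_mpullback Z]
    exact hC.quotientForm_mfderiv_proj x _ _
  have h4 : quotientForm C (proj x) (Y (proj x)) (quotientConnection Z (proj x)
      (mfderiv 𝓘(ℝ, R4) 𝓘(ℝ, R4) proj x v)) =
      constForm C (Y' x) (coverConnection Z' x v) := by
    rw [← projectsTo_quotientConnection x Z hZ v, ← mfderiv_proj_mpullback Y]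
    exact hC.quotientForm_mfderiv_proj x _ _
  refine Eq.trans ?_ (congrArg₂ (· + ·) h3 h4).symm
  have h5 := hC.skew x v (components Y' x) (components Z' x)
  have h6 : constForm C (coverConnection Y' x v) (Z' x) =
      constForm C (mvfderiv 𝓘(ℝ, R4) (components Y') x v) (components Z' x) +
      constForm C (thetaBilin x (components Y' x) v) (components Z' x) :=
    congrArg (fun L ↦ L (components Z' x)) ((constFormCLM C).map_add
      (mvfderiv 𝓘(ℝ, R4) (components Y') x v) (thetaBilin x (components Y' x) v))
  have h7 : constForm C (Y' x) (coverConnection Z' x v) =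
      constForm C (components Y' x) (mvfderiv 𝓘(ℝ, R4) (components Z') x v) +
      constForm C (components Y' x) (thetaBilin x (components Z' x) v) :=
    (constFormCLM C (components Y' x)).map_add
      (mvfderiv 𝓘(ℝ, R4) (components Z') x v) (thetaBilin x (components Z' x) v)
  simp only [h6, h7]
  linarith

/-! ### Topology of M -/

theorem t2Space_quotientM : T2Space quotientM :=
  t2Space_of_properlyDiscontinuousSMul_of_t2Space

theorem secondCountableTopology_quotientM : SecondCountableTopology quotientM :=
  ContinuousConstSMul.secondCountableTopology

/-- The coordinate `x¹ + (1 + √2) x⁴`, one of the two linear equations of `E`. -/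
def eqP (x : R4) : ℝ := x 0 + (1 + √2) * x 3

/-- The coordinate `(1 + √2) x² - x³`, one of the two linear equations of `E`. -/
def eqQ (x : R4) : ℝ := (1 + √2) * x 1 - x 2

theorem mem_eigenE_iff (x : R4) : x ∈ eigenE ↔ eqP x = 0 ∧ eqQ x = 0 := by
  have h : √2 * √2 = 2 := by norm_num
  rw [mem_eigenE, show Matrix.toEuclideanLin matG x = linAct genG x from rfl, linAct_genG]
  constructor
  · intro hx
    have h1 := congrArg (fun v : R4 ↦ v 3) hx
    have h2 := congrArg (fun v : R4 ↦ v 1) hx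
    simp at h1 h2
    constructor
    · rw [eqP]; linarith
    · rw [eqQ]; linarith
  · rintro ⟨h1, h2⟩
    rw [eqP] at h1
    rw [eqQ] at h2
    ext i
    fin_cases i <;> simp
    · linear_combination (√2 - 1) * h1 - x 3 * h
    · linear_combination -h2
    · linear_combination (1 - √2) * h2 + x 1 * h
    · linear_combination -h1

theorem mem_cover_iff (x : R4) : x ∈ cover ↔ eqP x ≠ 0 ∨ eqQ x ≠ 0 := by
  rw [show x ∈ cover ↔ ¬ x ∈ eigenE from Iff.rfl, mem_eigenE_iff]
  tauto

/-- The two linear equations of `E` as a linear map. -/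
def eqPQ : R4 →ₗ[ℝ] ℝ × ℝ where
  toFun x := (eqP x, eqQ x)
  map_add' x y := by
    ext <;> simp [eqP, eqQ] <;> ring
  map_smul' c x := by
    ext <;> simp [eqP, eqQ] <;> ring

theorem ker_eqPQ : LinearMap.ker eqPQ = eigenE := by
  ext x
  rw [LinearMap.mem_ker, mem_eigenE_iff]
  exact Prod.mk_eq_zero

theorem eqPQ_surjective : Function.Surjective eqPQ := by
  rintro ⟨a, b⟩
  refine ⟨!₂[a, 0, -b, 0], ?_⟩
  ext <;> simp [eqPQ, eqP, eqQ]

instance pathConnectedSpace_cover : PathConnectedSpace cover := by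
  have h : IsPathConnected ((eigenE : Set R4)ᶜ) := by
    refine isPathConnected_compl_of_one_lt_codim ?_
    -- The two equations identify ℝ⁴/E with ℝ², so E has codimension two.
    rw [← ker_eqPQ, (eqPQ.quotKerEquivOfSurjective eqPQ_surjective).rank_eq]
    simp only [rank_prod', Module.rank_self, one_add_one_eq_two]
    exact Cardinal.one_lt_two
  exact isPathConnected_iff_pathConnectedSpace.1 h

theorem connectedSpace_quotientM : ConnectedSpace quotientM :=
  proj_surjective.connectedSpace continuous_proj

theorem cover_nonempty : Nonempty cover := inferInstance

theorem genG_ne_one : genG ≠ 1 := by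
  obtain ⟨x⟩ := cover_nonempty
  intro h
  exact unitG_smul_ne x (by rw [show (⟨unitG, Or.inr rfl⟩ : groupG) = 1 from h, one_smul])

/-- The cover is path connected, so monodromy maps π₁(M) onto the (opposite) deck group, which is
nontrivial. -/
theorem not_simplyConnectedSpace_quotientM : ¬ SimplyConnectedSpace quotientM := by
  intro _
  obtain ⟨x⟩ := cover_nonempty
  have hs := isQuotientCoveringMap_proj.fundamentalGroupToMulOpposite_surjective
    (x := proj x) ⟨x, rfl⟩
  have : Subsingleton (FundamentalGroup quotientM (proj x)) := inferInstance
  have h2 := hs.subsingleton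
  exact genG_ne_one (MulOpposite.op_injective (Subsingleton.elim _ _))

/-! ### Signature and linear independence -/

theorem ncard_pos_pair (w : Fin 4 → ℝ) (h0 : 0 < w 0) (h1 : 0 < w 1) (h2 : w 2 < 0)
    (h3 : w 3 < 0) : {i | 0 < w i}.ncard = 2 ∧ {i | w i < 0}.ncard = 2 := by
  constructor
  · rw [show {i | 0 < w i} = {0, 1} by
      ext i; fin_cases i <;> simp [h0, h1, h2.le, h3.le]]
    exact Set.ncard_pair (by decide)
  · rw [show {i | w i < 0} = {2, 3} by
      ext i; fin_cases i <;> simp [h0.le, h1.le, h2, h3]]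
    exact Set.ncard_pair (by decide)

theorem hasSignature_of_linearEquiv {C : Matrix (Fin 4) (Fin 4) ℝ} (hC : IsInvariantForm C)
    (w : Fin 4 → ℝ) (h0 : 0 < w 0) (h1 : 0 < w 1) (h2 : w 2 < 0) (h3 : w 3 < 0)
    (e : R4 ≃ₗ[ℝ] (Fin 4 → ℝ)) (he : ∀ v, ∑ i, w i * (e v i * e v i) = constForm C v v) :
    (quotientMetric hC).HasSignature 2 2 := by
  intro q
  have h : ((quotientMetric hC).quadraticForm q).Equivalent
      (QuadraticMap.weightedSumSquares ℝ w) :=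
    ⟨⟨e, fun v ↦ by
      rw [QuadraticMap.weightedSumSquares_apply]
      simp only [smul_eq_mul]
      exact he v⟩⟩
  rw [h.sigPos_eq, h.sigNeg_eq, QuadraticForm.sigPos_weightedSumSquares,
    QuadraticForm.sigNeg_weightedSumSquares]
  exact ncard_pos_pair w h0 h1 h2 h3

theorem hasSignature_matK : (quotientMetric isInvariantForm_matK).HasSignature 2 2 := by
  refine hasSignature_of_linearEquiv _ ![1, 1, -1, -1] (by simp) (by simp) (by simp) (by simp)
    (WithLp.linearEquiv 2 ℝ (Fin 4 → ℝ)) fun v ↦ ?_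
  rw [constForm_matK]
  simp [Fin.sum_univ_four]
  ring

/-- The linear change of coordinates that diagonalizes `∑ L i j dxⁱ ⊗ dxʲ`. -/
def diagonalizeL : R4 ≃ₗ[ℝ] (Fin 4 → ℝ) where
  toFun v := ![v 0 + v 2, v 1 + v 3, v 0 - v 2, v 1 - v 3]
  invFun u := !₂[(u 0 + u 2) / 2, (u 1 + u 3) / 2, (u 0 - u 2) / 2, (u 1 - u 3) / 2]
  map_add' v w := by ext i; fin_cases i <;> simp <;> ring
  map_smul' c v := by ext i; fin_cases i <;> simp <;> ring
  left_inv v := by ext i; fin_cases i <;> simp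
  right_inv v := by ext i; fin_cases i <;> simp <;> ring

theorem hasSignature_matL : (quotientMetric isInvariantForm_matL).HasSignature 2 2 := by
  refine hasSignature_of_linearEquiv _ ![1 / 2, 1 / 2, -1 / 2, -1 / 2] (by simp) (by simp)
    (by simp; norm_num) (by simp; norm_num) diagonalizeL fun v ↦ ?_
  rw [constForm_matL]
  simp [Fin.sum_univ_four, diagonalizeL]
  ring

/-- Evaluation at `(v, v)` isolates the coefficient of `B₁`; evaluation at `(v, w)` then gives that
of `B₂`. -/
theorem linearIndependent_bilinear {B₁ B₂ : R4 →L[ℝ] R4 →L[ℝ] ℝ} {v w : R4}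
    (h₁ : B₁ v v ≠ 0) (h₂ : B₂ v v = 0) (h₃ : B₂ v w ≠ 0) : LinearIndependent ℝ ![B₁, B₂] := by
  refine LinearIndependent.pair_iffₛ.2 fun s t s' t' h ↦ ?_
  have h' : ∀ a b, s * B₁ a b + t * B₂ a b = s' * B₁ a b + t' * B₂ a b := fun a b ↦
    congrArg (fun B : R4 →L[ℝ] R4 →L[ℝ] ℝ ↦ B a b) h
  have hs : s = s' := by
    have := h' v v
    rw [h₂, mul_zero, add_zero, mul_zero, add_zero] at this
    exact mul_right_cancel₀ h₁ this
  have ht := h' v w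
  rw [hs, add_right_inj] at ht
  exact ⟨hs, mul_right_cancel₀ h₃ ht⟩

theorem linearIndependent_quotientMetric (q : quotientM) :
    LinearIndependent ℝ ![(quotientMetric isInvariantForm_matK).form q,
      (quotientMetric isInvariantForm_matL).form q] := by
  refine linearIndependent_bilinear (v := EuclideanSpace.single 0 1)
    (w := EuclideanSpace.single 2 1) ?_ ?_ ?_
  · change constForm matK _ _ ≠ 0
    simp [constForm_matK]
  · change constForm matL _ _ = 0
    simp [constForm_matL]
  · change constForm matL _ _ ≠ 0
    simp [constForm_matL]

/-! ### Parallel fields along projected curves -/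

theorem hasMFDerivWithinAt_cover {γ : ℝ → cover} {v : R4} {s : Set ℝ} {t : ℝ}
    (h : HasDerivWithinAt (fun r ↦ (γ r : R4)) v s t) :
    HasMFDerivWithinAt 𝓘(ℝ, ℝ) 𝓘(ℝ, R4) γ s t (ContinuousLinearMap.toSpanSingleton ℝ v) :=
  ⟨(Topology.IsInducing.subtypeVal.continuousWithinAt_iff).2 h.continuousWithinAt,
    h.hasFDerivWithinAt.hasMFDerivWithinAt.2⟩

theorem velocity_proj {γ : ℝ → cover} {v : R4} {t : ℝ} (ht : t ∈ Set.Icc (0 : ℝ) 1)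
    (h : HasDerivWithinAt (fun r ↦ (γ r : R4)) v (Set.Icc 0 1) t) :
    velocity (I := 𝓘(ℝ, R4)) (fun s ↦ proj (γ s)) t =
      mfderiv 𝓘(ℝ, R4) 𝓘(ℝ, R4) proj (γ t) v := by
  have hu : UniqueMDiffWithinAt 𝓘(ℝ, ℝ) (Set.Icc (0 : ℝ) 1) t :=
    ((uniqueDiffOn_Icc zero_lt_one) t ht).uniqueMDiffWithinAt
  have h1 := (mdifferentiableAt_proj (γ t)).hasMFDerivAt.comp_hasMFDerivWithinAt t
    (hasMFDerivWithinAt_cover h)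
  have h2 := congrArg (fun L ↦ L (1 : ℝ)) (h1.mfderivWithin hu)
  refine Eq.trans h2 ?_
  change mfderiv 𝓘(ℝ, R4) 𝓘(ℝ, R4) proj (γ t) ((1 : ℝ) • v : R4) = _
  rw [one_smul]

theorem mdifferentiableAt_constantField (q : quotientM) (w : TangentSpace 𝓘(ℝ, R4) q) :
    MDifferentiableAt 𝓘(ℝ, R4) 𝓘(ℝ, R4).tangent
      (fun p ↦ (⟨p, constantField q w p⟩ : TangentBundle 𝓘(ℝ, R4) quotientM)) q := by
  refine (mdifferentiableAt_section _ _).2 ?_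
  refine (mdifferentiableAt_const (c := chartCoord q q w)).congr_of_eventuallyEq ?_
  filter_upwards [(trivializationAt R4
    (TangentSpace 𝓘(ℝ, R4) : quotientM → Type _) q).open_baseSet.mem_nhds
      (FiberBundle.mem_baseSet_trivializationAt' q)] with p hp
  exact (congrArg Prod.snd (Trivialization.apply_mk_symm _ hp (chartCoord q q w)) :)

/-- The chart of M differs from the inclusion by a fixed matrix near `x`. The pulled-back field is
therefore locally constant, its flat derivative vanishes, and only the θ term survives. -/
theorem coverConnection_mpullback_constantField (x : cover) (w v : TangentSpace 𝓘(ℝ, R4) x) :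
    coverConnection (VectorField.mpullback 𝓘(ℝ, R4) 𝓘(ℝ, R4) proj
      (constantField (proj x) (mfderiv 𝓘(ℝ, R4) 𝓘(ℝ, R4) proj x w))) x v = thetaBilin x w v := by
  set Z := VectorField.mpullback 𝓘(ℝ, R4) 𝓘(ℝ, R4) proj
      (constantField (proj x) (mfderiv 𝓘(ℝ, R4) 𝓘(ℝ, R4) proj x w)) with hZdef
  have hZ : ∀ᶠ y in 𝓝 x, components Z y = w := by
    filter_upwards [eventually_trivializationAt_symm_proj x] with y hy
    refine (mpullback_proj _ y).trans ?_
    have h1 := hy (chartCoord (proj x) (proj x) (mfderiv 𝓘(ℝ, R4) 𝓘(ℝ, R4) proj x w))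
    have h2 : constantField (proj x) (mfderiv 𝓘(ℝ, R4) 𝓘(ℝ, R4) proj x w) (proj y) =
        (linAct (deck y) w : R4) := by
      refine h1.trans ?_
      rw [chartCoord_mfderiv_proj, mfderiv_proj]
      exact congrArg (linAct (deck y)) (linAct_inv_linAct _ _)
    rw [h2]
    exact linAct_inv_linAct _ _
  have h3 : mvfderiv 𝓘(ℝ, R4) (components Z) x = 0 := by
    have h4 := HasMFDerivAt.congr_of_eventuallyEq
      (hasMFDerivAt_const (M' := R4) (I := 𝓘(ℝ, R4)) (I' := 𝓘(ℝ, R4)) w x) hZ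
    exact h4.mfderiv
  rw [coverConnection_apply, h3]
  have h5 : components Z x = w := hZ.self_of_nhds
  refine (zero_add _).trans ?_
  exact congrArg (fun u : R4 ↦ thetaBilin x u v) h5

theorem quotientConnection_constantField (x : cover) (w v : TangentSpace 𝓘(ℝ, R4) x) :
    quotientConnection (constantField (proj x) (mfderiv 𝓘(ℝ, R4) 𝓘(ℝ, R4) proj x w)) (proj x)
      (mfderiv 𝓘(ℝ, R4) 𝓘(ℝ, R4) proj x v) =
      mfderiv 𝓘(ℝ, R4) 𝓘(ℝ, R4) proj x (thetaBilin x w v) := by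
  rw [← projectsTo_quotientConnection x _ (mdifferentiableAt_constantField _ _) v,
    coverConnection_mpullback_constantField]

/-- A solution of the parallel transport equation of `∇'` projects to a parallel field on `M`. -/
theorem isParallelAlong_proj {γ : ℝ → cover} {γ' V : ℝ → R4}
    (hγ : ∀ t ∈ Set.Icc (0 : ℝ) 1,
      HasDerivWithinAt (fun s ↦ (γ s : R4)) (γ' t) (Set.Icc 0 1) t)
    (hV : ∀ t ∈ Set.Icc (0 : ℝ) 1,
      HasDerivWithinAt V (-(thetaBilin (γ t) (V t) (γ' t))) (Set.Icc 0 1) t) :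
    IsParallelAlong quotientConnection (fun t ↦ proj (γ t))
      (fun t ↦ mfderiv 𝓘(ℝ, R4) 𝓘(ℝ, R4) proj (γ t) (V t)) := by
  intro t ht
  have hc : ContinuousWithinAt γ (Set.Icc 0 1) t := (hasMFDerivWithinAt_cover (hγ t ht)).1
  have h1 : ∀ᶠ s in 𝓝[Set.Icc 0 1] t,
      chartCoord (proj (γ t)) (proj (γ s)) (mfderiv 𝓘(ℝ, R4) 𝓘(ℝ, R4) proj (γ s) (V s)) =
        linAct (deck (γ t)) (V s) := by
    filter_upwards [hc (eventually_trivializationAt_mfderiv_proj (γ t))] with s hs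
    exact hs (V s)
  have h2 := ((linAct (deck (γ t))).hasFDerivAt.comp_hasDerivWithinAt t (hV t ht))
  have h3 := h2.congr_of_eventuallyEq h1 (h1.self_of_nhdsWithin ht)
  refine h3.congr_deriv ?_
  rw [velocity_proj ht (hγ t ht)]
  refine Eq.trans ?_ (congrArg (fun u ↦ chartCoord (proj (γ t)) (proj (γ t)) (-u))
    (quotientConnection_constantField (γ t) (V t) (γ' t))).symm
  refine Eq.trans ?_ (chartCoord_neg _ _).symm
  exact (map_neg (linAct (deck (γ t))) _).trans
    (congrArg Neg.neg (chartCoord_mfderiv_proj (γ t) (thetaBilin (γ t) (V t) (γ' t)))).symm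

/-! ### The matrices A and B and their exponentials -/

/-- The coefficient of `α` in `θ`. -/
def opA : R4 →ₗ[ℝ] R4 where
  toFun w := !₂[w 1, -w 0, w 3, -w 2]
  map_add' v w := by ext i; fin_cases i <;> simp <;> ring
  map_smul' c v := by ext i; fin_cases i <;> simp

/-- The coefficient of `β` in `θ`. -/
def opB : R4 →ₗ[ℝ] R4 where
  toFun w := !₂[w 3, -w 2, -w 1, w 0]
  map_add' v w := by ext i; fin_cases i <;> simp <;> ring
  map_smul' c v := by ext i; fin_cases i <;> simp

theorem opA_apply (w : R4) : opA w = !₂[w 1, -w 0, w 3, -w 2] := rfl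
theorem opB_apply (w : R4) : opB w = !₂[w 3, -w 2, -w 1, w 0] := rfl

theorem opA_opA (w : R4) : opA (opA w) = -w := by
  ext i; fin_cases i <;> simp [opA_apply]

theorem opB_opB (w : R4) : opB (opB w) = w := by
  ext i; fin_cases i <;> simp [opB_apply]

theorem opB_opA (w : R4) : opB (opA w) = opA (opB w) := by
  ext i; fin_cases i <;> simp [opA_apply, opB_apply]

theorem thetaBilin_eq (x w v : R4) :
    thetaBilin x w v = formAlpha x v • opA w + formBeta x v • opB w := by
  rw [thetaBilin_apply, opA_apply, opB_apply]
  ext i; fin_cases i <;> simp <;> ring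

/-- The linear map `exp (-(a A + b B))`, where `A` and `B` are the coefficients of `θ`. -/
def expOp (a b : ℝ) : R4 →ₗ[ℝ] R4 :=
  (Real.cos a * Real.cosh b) • LinearMap.id - (Real.sin a * Real.cosh b) • opA -
    (Real.cos a * Real.sinh b) • opB + (Real.sin a * Real.sinh b) • (opA ∘ₗ opB)

theorem expOp_apply (a b : ℝ) (w : R4) : expOp a b w =
    (Real.cos a * Real.cosh b) • w - (Real.sin a * Real.cosh b) • opA w -
    (Real.cos a * Real.sinh b) • opB w + (Real.sin a * Real.sinh b) • opA (opB w) := rfl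

theorem expOp_zero (w : R4) : expOp 0 0 w = w := by
  simp [expOp_apply]

/-- The addition formulas for the circular and hyperbolic functions, combined with A² = -1, B² = 1
and AB = BA. -/
theorem expOp_expOp (a b a' b' : ℝ) (w : R4) :
    expOp a b (expOp a' b' w) = expOp (a' + a) (b' + b) w := by
  simp only [expOp_apply, map_add, map_sub, map_smul, opA_opA, opB_opB, opB_opA,
    Real.cos_add, Real.sin_add, Real.cosh_add, Real.sinh_add]
  module

/-- This is the transport equation along a curve on which α and β of the velocity are the constants
`a` and `b`. -/
theorem hasDerivAt_expOp (a b : ℝ) (w : R4) (t : ℝ) :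
    HasDerivAt (fun t ↦ expOp (t * a) (t * b) w)
      (-(a • opA (expOp (t * a) (t * b) w) + b • opB (expOp (t * a) (t * b) w))) t := by
  have hc : HasDerivAt (fun t : ℝ ↦ Real.cos (t * a)) (-Real.sin (t * a) * a) t :=
    (Real.hasDerivAt_cos _).comp t (by simpa using (hasDerivAt_id t).mul_const a)
  have hs : HasDerivAt (fun t : ℝ ↦ Real.sin (t * a)) (Real.cos (t * a) * a) t :=
    (Real.hasDerivAt_sin _).comp t (by simpa using (hasDerivAt_id t).mul_const a)
  have hC : HasDerivAt (fun t : ℝ ↦ Real.cosh (t * b)) (Real.sinh (t * b) * b) t :=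
    (Real.hasDerivAt_cosh _).comp t (by simpa using (hasDerivAt_id t).mul_const b)
  have hS : HasDerivAt (fun t : ℝ ↦ Real.sinh (t * b)) (Real.cosh (t * b) * b) t :=
    (Real.hasDerivAt_sinh _).comp t (by simpa using (hasDerivAt_id t).mul_const b)
  have h := ((((hc.mul hC).smul_const w).sub ((hs.mul hC).smul_const (opA w))).sub
    ((hc.mul hS).smul_const (opB w))).add ((hs.mul hS).smul_const (opA (opB w)))
  refine h.congr_deriv ?_
  simp only [expOp_apply, map_add, map_sub, map_smul, opA_opA, opB_opB, opB_opA]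
  module

/-- `expOp` as a linear equivalence. -/
def expEquiv (a b : ℝ) : R4 ≃ₗ[ℝ] R4 :=
  LinearEquiv.ofLinearMap (expOp a b) (expOp (-a) (-b))
    (by ext1 w; simp [expOp_expOp, expOp_zero])
    (by ext1 w; simp [expOp_expOp, expOp_zero])

theorem expEquiv_apply (a b : ℝ) (w : R4) : expEquiv a b w = expOp a b w := rfl

theorem expEquiv_trans (a b a' b' : ℝ) :
    (expEquiv a b).trans (expEquiv a' b') = expEquiv (a + a') (b + b') :=
  LinearEquiv.ext fun w ↦ expOp_expOp a' b' a b w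

/-! ### Parallel transport on M computed on the cover -/

/-- The map between tangent spaces of `M` induced by a map between tangent spaces of the cover. -/
def descend (x y : cover) (S : R4 ≃ₗ[ℝ] R4) :
    TangentSpace 𝓘(ℝ, R4) (proj x) ≃ₗ[ℝ] TangentSpace 𝓘(ℝ, R4) (proj y) :=
  ((linActEquiv (deck x)).symm.toLinearEquiv.trans S).trans (linActEquiv (deck y)).toLinearEquiv

theorem descend_apply (x y : cover) (S : R4 ≃ₗ[ℝ] R4) (v : R4) :
    (descend x y S v : R4) = linAct (deck y) (S (linAct (deck x)⁻¹ v)) := rfl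

/-- `S` becomes a parallel transport on `M` after projection. -/
def IsCoverTransport (x y : cover) (S : R4 ≃ₗ[ℝ] R4) : Prop :=
  IsTransport quotientConnection (proj x) (proj y) (descend x y S)

theorem IsCoverTransport.trans {x y z : cover} {S S' : R4 ≃ₗ[ℝ] R4} (h : IsCoverTransport x y S)
    (h' : IsCoverTransport y z S') : IsCoverTransport x z (S.trans S') := by
  have h1 := IsTransport.trans h h'
  have h2 : (descend x y S).trans (descend y z S') = descend x z (S.trans S') := by
    refine LinearEquiv.ext fun v ↦ ?_
    change linAct (deck z) (S' (linAct (deck y)⁻¹ (linAct (deck y) (S (linAct (deck x)⁻¹ v))))) = _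
    rw [linAct_inv_linAct]
    rfl
  rwa [h2] at h1

/-- Two lifts of a point have provably but not definitionally equal projections, so the trivial
transport has to be available across such an equality. -/
theorem isTransport_of_eq (q : quotientM) {q' : quotientM} (h : q' = q)
    (P : TangentSpace 𝓘(ℝ, R4) q ≃ₗ[ℝ] TangentSpace 𝓘(ℝ, R4) q')
    (hP : ∀ v : R4, (P v : R4) = v) : IsTransport quotientConnection q q' P := by
  subst h
  rw [show P = LinearEquiv.refl ℝ _ from LinearEquiv.ext hP]
  exact IsTransport.refl _

/-- Changing the lift from `x` to `g • x` does not move the point of M: the identity of its tangent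
space, read on the cover, is multiplication by `g`. This is how G enters the holonomy. -/
theorem isCoverTransport_smul (g : groupG) (x : cover) :
    IsCoverTransport x (g • x) (linActEquiv g).toLinearEquiv := by
  refine isTransport_of_eq _ (proj_smul g x) _ fun v ↦ ?_
  refine (descend_apply _ _ _ v).trans ?_
  rw [deck_smul_eq, linAct_mul]
  change linAct (deck x) (linAct g⁻¹ (linAct g (linAct (deck x)⁻¹ v))) = v
  rw [linAct_inv_linAct, linAct_linAct_inv]

/-- The affine segment from `x` to `y` in the cover, constant outside `[0,1]`. -/
def segmentCurve (x y : cover)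
    (h : ∀ t ∈ Set.Icc (0 : ℝ) 1, (x : R4) + t • ((y : R4) - x) ∈ cover) (t : ℝ) : cover :=
  ⟨x + (Set.projIcc (0 : ℝ) 1 zero_le_one t : ℝ) • ((y : R4) - x),
    h _ (Set.projIcc (0 : ℝ) 1 zero_le_one t).2⟩

theorem segmentCurve_of_mem {x y : cover}
    (h : ∀ t ∈ Set.Icc (0 : ℝ) 1, (x : R4) + t • ((y : R4) - x) ∈ cover) {t : ℝ}
    (ht : t ∈ Set.Icc (0 : ℝ) 1) : (segmentCurve x y h t : R4) = x + t • ((y : R4) - x) :=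
  congrArg (fun s : Set.Icc (0 : ℝ) 1 ↦ (x : R4) + (s : ℝ) • ((y : R4) - x))
    (Set.projIcc_of_mem _ ht)

/-- α is alternating bilinear in position and velocity, so it is constant along an affine segment.
-/
theorem formAlpha_segment (x y : R4) (t : ℝ) :
    formAlpha (x + t • (y - x)) (y - x) = formAlpha x y := by
  simp [formAlpha]; ring

theorem formBeta_segment (x y : R4) (t : ℝ) :
    formBeta (x + t • (y - x)) (y - x) = formBeta x y := by
  simp [formBeta]; ring

theorem isCoverTransport_segment {x y : cover}
    (h : ∀ t ∈ Set.Icc (0 : ℝ) 1, (x : R4) + t • ((y : R4) - x) ∈ cover) :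
    IsCoverTransport x y (expEquiv (formAlpha x y) (formBeta x y)) := by
  have h0 : segmentCurve x y h 0 = x := Subtype.ext (by
    rw [segmentCurve_of_mem h (by simp)]; simp)
  have h1 : segmentCurve x y h 1 = y := Subtype.ext (by
    rw [segmentCurve_of_mem h (by simp)]; simp)
  have hd : ∀ t ∈ Set.Icc (0 : ℝ) 1, HasDerivWithinAt (fun s ↦ (segmentCurve x y h s : R4))
      ((y : R4) - x) (Set.Icc 0 1) t := by
    intro t ht
    have h2 : HasDerivAt (fun s : ℝ ↦ (x : R4) + s • ((y : R4) - x)) ((y : R4) - x) t := by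
      simpa using ((hasDerivAt_id t).smul_const ((y : R4) - x)).const_add (x : R4)
    exact h2.hasDerivWithinAt.congr (fun s hs ↦ segmentCurve_of_mem h hs)
      (segmentCurve_of_mem h ht)
  refine (IsTransport.refl (proj x)).snoc (P := LinearEquiv.refl ℝ _) (Q := descend x y _) ?_
  refine ⟨fun t ↦ proj (segmentCurve x y h t), ?_, congrArg proj h0, congrArg proj h1, ?_⟩
  · refine contMDiff_proj.comp_contMDiffOn fun t ht ↦ ?_
    rw [contMDiffWithinAt_cover_iff]
    refine ContMDiffWithinAt.congr (f := fun s : ℝ ↦ (x : R4) + s • ((y : R4) - x)) ?_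
      (fun s hs ↦ segmentCurve_of_mem h hs) (segmentCurve_of_mem h ht)
    refine ContDiffWithinAt.contMDiffWithinAt ?_
    fun_prop
  · intro v
    have hpar := isParallelAlong_proj (γ := segmentCurve x y h) (γ' := fun _ ↦ (y : R4) - x)
      (V := fun t ↦ expOp (t * formAlpha x y) (t * formBeta x y) (linAct (deck x)⁻¹ v)) hd
      (fun t ht ↦ by
        refine (hasDerivAt_expOp _ _ _ t).hasDerivWithinAt.congr_deriv ?_
        rw [thetaBilin_eq, segmentCurve_of_mem h ht, formAlpha_segment, formBeta_segment])
    refine ⟨_, hpar, ?_, ?_⟩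
    -- The endpoint is replaced by a variable so that its equality with `x` can be substituted in
    -- the dependent type.
    · have key : ∀ z : cover, z = x →
          (⟨proj z, mfderiv 𝓘(ℝ, R4) 𝓘(ℝ, R4) proj z
            (expOp (0 * formAlpha x y) (0 * formBeta x y) (linAct (deck x)⁻¹ v))⟩ :
            TangentBundle 𝓘(ℝ, R4) quotientM) = ⟨proj x, v⟩ := by
        rintro z rfl
        rw [zero_mul, zero_mul, expOp_zero, mfderiv_proj]
        exact congrArg (TotalSpace.mk (proj z)) (linAct_linAct_inv (deck z) v)
      exact key _ h0
    · have key : ∀ z : cover, z = y →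
          (⟨proj z, mfderiv 𝓘(ℝ, R4) 𝓘(ℝ, R4) proj z
            (expOp (1 * formAlpha x y) (1 * formBeta x y) (linAct (deck x)⁻¹ v))⟩ :
            TangentBundle 𝓘(ℝ, R4) quotientM) =
          ⟨proj y, descend x y (expEquiv (formAlpha x y) (formBeta x y)) v⟩ := by
        rintro z rfl
        rw [one_mul, one_mul, mfderiv_proj]
        rfl
      exact key _ h1

/-! ### Loops in M: half turns around E and small triangles -/

theorem eqP_segment (x y : R4) (t : ℝ) :
    eqP (x + t • (y - x)) = (1 - t) * eqP x + t * eqP y := by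
  simp [eqP]; ring

theorem eqQ_segment (x y : R4) (t : ℝ) :
    eqQ (x + t • (y - x)) = (1 - t) * eqQ x + t * eqQ y := by
  simp [eqQ]; ring

/-- A segment avoids `E` if the equations of `E` turn by a right angle along it. -/
theorem segment_mem_cover {x y : cover} (hP : eqP y = -eqQ x) (hQ : eqQ y = eqP x) (t : ℝ) :
    (x : R4) + t • ((y : R4) - x) ∈ cover := by
  rw [mem_cover_iff]
  by_contra! h
  obtain ⟨h1, h2⟩ := h
  rw [eqP_segment, hP] at h1
  rw [eqQ_segment, hQ] at h2
  -- With z = `eqP x` + i `eqQ x`, the point at time t has value ((1 - t) + it) z. The next two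
  -- lines multiply by the conjugate of the factor, whose squared modulus is positive.
  have ht : 0 < (1 - t) ^ 2 + t ^ 2 := by nlinarith [sq_nonneg (1 - 2 * t)]
  have hp : ((1 - t) ^ 2 + t ^ 2) * eqP x = 0 := by linear_combination (1 - t) * h1 + t * h2
  have hq : ((1 - t) ^ 2 + t ^ 2) * eqQ x = 0 := by linear_combination (1 - t) * h2 - t * h1
  have hx := (mem_cover_iff x).1 x.2
  rcases hx with hx | hx
  · exact hx ((mul_eq_zero.1 hp).resolve_left ht.ne')
  · exact hx ((mul_eq_zero.1 hq).resolve_left ht.ne')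

theorem eqP_genG (x : R4) : eqP (linAct genG x) = -eqP x := by
  have h : √2 * √2 = 2 := by norm_num
  rw [linAct_genG]
  simp [eqP]
  linear_combination -x 3 * h

theorem eqQ_genG (x : R4) : eqQ (linAct genG x) = -eqQ x := by
  have h : √2 * √2 = 2 := by norm_num
  rw [linAct_genG]
  simp [eqQ]
  linear_combination -x 1 * h

/-- G acts as -1 on ℝ⁴/E, so the direct segment from x to Gx meets E at its midpoint. Two quarter
turns in ℝ⁴/E, through an intermediate point, avoid E. -/
theorem exists_isCoverTransport_genG (x : cover) :
    ∃ a b, IsCoverTransport x (genG • x) (expEquiv a b) := by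
  obtain ⟨y, hy⟩ := eqPQ_surjective (-eqQ x, eqP x)
  have hP : eqP y = -eqQ x := congrArg Prod.fst hy
  have hQ : eqQ y = eqP x := congrArg Prod.snd hy
  have hy' : y ∈ cover := by
    rw [mem_cover_iff, hP, hQ, neg_ne_zero]
    exact ((mem_cover_iff x).1 x.2).symm
  have h1 := isCoverTransport_segment (x := x) (y := ⟨y, hy'⟩)
    fun t _ ↦ segment_mem_cover hP hQ t
  have h2 := isCoverTransport_segment (x := ⟨y, hy'⟩) (y := genG • x)
    fun t _ ↦ segment_mem_cover (by rw [coe_smul_eq_linAct, eqP_genG, hQ])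
      (by rw [coe_smul_eq_linAct, eqQ_genG, hP]) t
  have h3 := h1.trans h2
  rw [expEquiv_trans] at h3
  exact ⟨_, _, h3⟩

/-- The loop is the triangle x, x + u, x + w. The exponents of its sides add up, and by bilinearity
and antisymmetry every term in x cancels, leaving α(u, w) and β(u, w). -/
theorem exists_isCoverTransport_triangle (x : cover) :
    ∃ ε > 0, ∀ u w : R4, ‖u‖ < ε → ‖w‖ < ε →
      IsCoverTransport x x (expEquiv (formAlpha u w) (formBeta u w)) := by
  obtain ⟨ε, hε, hb⟩ := Metric.isOpen_iff.1 cover.isOpen x x.2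
  refine ⟨ε, hε, fun u w hu hw ↦ ?_⟩
  have hx : (x : R4) ∈ Metric.ball (x : R4) ε := Metric.mem_ball_self hε
  have hu' : (x : R4) + u ∈ Metric.ball (x : R4) ε := by simpa using hu
  have hw' : (x : R4) + w ∈ Metric.ball (x : R4) ε := by simpa using hw
  have hseg : ∀ y z : cover, (y : R4) ∈ Metric.ball (x : R4) ε → (z : R4) ∈ Metric.ball (x : R4) ε →
      IsCoverTransport y z (expEquiv (formAlpha y z) (formBeta y z)) := fun y z hy hz ↦
    isCoverTransport_segment fun t ht ↦ hb ((convex_ball _ _).add_smul_sub_mem hy hz ht)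
  have h := ((hseg x ⟨_, hb hu'⟩ hx hu').trans (hseg ⟨_, hb hu'⟩ ⟨_, hb hw'⟩ hu' hw')).trans
    (hseg ⟨_, hb hw'⟩ x hw' hx)
  rw [expEquiv_trans, expEquiv_trans] at h
  convert h using 2
  · simp [formAlpha]; ring
  · simp [formBeta]; ring

/-! ### Irreducibility -/

/-- The vectors f₊ = (1,0,0,1) and f₋ = (1,0,0,-1) lie in the eigenspaces of B for 1 and -1;
together with their images under A they form a basis. -/
theorem eq_top_of_mem_of_mem {W : Submodule ℝ R4} (hA : ∀ w ∈ W, opA w ∈ W)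
    (h₁ : (!₂[1, 0, 0, 1] : R4) ∈ W) (h₂ : (!₂[1, 0, 0, -1] : R4) ∈ W) : W = ⊤ := by
  rw [Submodule.eq_top_iff']
  intro v
  have h : v = ((v 0 + v 3) / 2) • (!₂[1, 0, 0, 1] : R4) + ((v 0 - v 3) / 2) • !₂[1, 0, 0, -1] +
      ((v 2 - v 1) / 2) • opA !₂[1, 0, 0, 1] - ((v 1 + v 2) / 2) • opA !₂[1, 0, 0, -1] := by
    ext i
    fin_cases i <;> simp [opA_apply] <;> ring
  rw [h]
  exact W.sub_mem (W.add_mem (W.add_mem (W.smul_mem _ h₁) (W.smul_mem _ h₂))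
    (W.smul_mem _ (hA _ h₁))) (W.smul_mem _ (hA _ h₂))

/-- The linear maps `A`, `B` and `G` have no common invariant subspace. -/
theorem eq_bot_or_eq_top {W : Submodule ℝ R4} (hA : ∀ w ∈ W, opA w ∈ W)
    (hB : ∀ w ∈ W, opB w ∈ W) (hG : ∀ w ∈ W, linAct genG w ∈ W) : W = ⊥ ∨ W = ⊤ := by
  by_cases hW : W = ⊥
  · exact Or.inl hW
  right
  have hs : 1 < √2 := Real.lt_sqrt_of_sq_lt (by norm_num)
  obtain ⟨w, hw, hw0⟩ := W.ne_bot_iff.1 hW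
  have hp := W.add_mem hw (hB w hw)
  have hm := W.sub_mem hw (hB w hw)
  -- The vector w + Bw equals p f₊ - q A f₊ with p = w₀ + w₃ and q = w₁ - w₂, so the test is whether
  -- it vanishes. If it does, w - Bw cannot.
  by_cases h1 : (w 0 + w 3) ^ 2 + (w 1 - w 2) ^ 2 = 0
  · have h2 : (w 0 - w 3) ^ 2 + (w 1 + w 2) ^ 2 ≠ 0 := by
      intro h2
      refine hw0 ?_
      have e1 : w 0 + w 3 = 0 := by nlinarith [sq_nonneg (w 0 + w 3), sq_nonneg (w 1 - w 2)]
      have e2 : w 1 - w 2 = 0 := by nlinarith [sq_nonneg (w 0 + w 3), sq_nonneg (w 1 - w 2)]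
      have e3 : w 0 - w 3 = 0 := by nlinarith [sq_nonneg (w 0 - w 3), sq_nonneg (w 1 + w 2)]
      have e4 : w 1 + w 2 = 0 := by nlinarith [sq_nonneg (w 0 - w 3), sq_nonneg (w 1 + w 2)]
      ext i
      fin_cases i <;> simp <;> linarith
    have h3 : (!₂[1, 0, 0, -1] : R4) ∈ W := by
      have h4 := W.smul_mem ((w 0 - w 3) ^ 2 + (w 1 + w 2) ^ 2)⁻¹ (W.add_mem
        (W.smul_mem (w 0 - w 3) hm) (W.smul_mem (w 1 + w 2) (hA _ hm)))
      convert h4 using 1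
      ext i
      fin_cases i <;> simp [opA_apply, opB_apply] <;> field_simp <;> ring
    refine eq_top_of_mem_of_mem hA ?_ h3
    -- G exchanges the eigenspaces of B: G f₋ = (√2 - 1) f₊.
    have h5 := W.smul_mem (√2 - 1)⁻¹ (hG _ h3)
    convert h5 using 1
    have : √2 - 1 ≠ 0 := by linarith
    ext i
    fin_cases i <;> simp [linAct_genG] <;> field_simp <;> ring
  · have h3 : (!₂[1, 0, 0, 1] : R4) ∈ W := by
      -- Division in the complex structure A: p + qA is conjugate to the factor p - qA of f₊, and
      -- their product is p² + q².
      have h4 := W.smul_mem ((w 0 + w 3) ^ 2 + (w 1 - w 2) ^ 2)⁻¹ (W.add_mem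
        (W.smul_mem (w 0 + w 3) hp) (W.smul_mem (w 1 - w 2) (hA _ hp)))
      convert h4 using 1
      ext i
      fin_cases i <;> simp [opA_apply, opB_apply] <;> field_simp <;> ring
    refine eq_top_of_mem_of_mem hA h3 ?_
    have h5 := W.smul_mem (√2 + 1)⁻¹ (hG _ h3)
    convert h5 using 1
    have : √2 + 1 ≠ 0 := by linarith
    ext i
    fin_cases i <;> simp [linAct_genG] <;> field_simp <;> ring

theorem hasIrreducibleHolonomy_quotientConnection :
    HasIrreducibleHolonomy quotientConnection := by
  intro q W hW
  obtain ⟨x, rfl⟩ := proj_surjective q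
  set e : R4 ≃ₗ[ℝ] TangentSpace 𝓘(ℝ, R4) (proj x) := (linActEquiv (deck x)).toLinearEquiv
  set W' : Submodule ℝ R4 := W.comap e.toLinearMap with hW'
  have hinv : ∀ S : R4 ≃ₗ[ℝ] R4, IsCoverTransport x x S → ∀ w ∈ W', S w ∈ W' := by
    intro S hS w hw
    have h1 := hW (descend x x S) hS (e w) hw
    have h2 : descend x x S (e w) = e (S w) :=
      congrArg (fun u ↦ linAct (deck x) (S u)) (linAct_inv_linAct (deck x) w)
    rwa [h2] at h1
  obtain ⟨ε, hε, htri⟩ := exists_isCoverTransport_triangle x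
  -- The bound by ε keeps the triangle in the cover; the bound by 1 gives s² < π, so sin(s²) ≠ 0.
  set s : ℝ := min (ε / 2) 1 with hs
  have hs0 : 0 < s := by positivity
  have hs1 : s ≤ 1 := min_le_right _ _
  have hsε : s < ε := (min_le_left _ _).trans_lt (by linarith)
  have hnorm : ∀ i : Fin 4, ‖(EuclideanSpace.single i s : R4)‖ < ε := fun i ↦ by
    rwa [PiLp.norm_single, Real.norm_of_nonneg hs0.le]
  have hss : 0 < s * s := mul_pos hs0 hs0
  have hss1 : s * s ≤ 1 := by nlinarith
  have hA : ∀ w ∈ W', opA w ∈ W' := by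
    intro w hw
    -- For this triangle α = s² and β = 0, so the holonomy is cos(s²) - sin(s²) A. The basis vectors
    -- 1 and 2 isolate B in the same way.
    have h1 := hinv _ (htri (EuclideanSpace.single 0 s) (EuclideanSpace.single 3 s)
      (hnorm 0) (hnorm 3)) w hw
    rw [expEquiv_apply, expOp_apply] at h1
    simp only [formAlpha, formBeta] at h1
    simp at h1
    have hsin : Real.sin (s * s) ≠ 0 :=
      (Real.sin_pos_of_pos_of_lt_pi hss (hss1.trans_lt (by linarith [Real.pi_gt_three]))).ne'
    have h2 := W'.sub_mem (W'.smul_mem (Real.cos (s * s)) hw) h1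
    rw [sub_sub_cancel] at h2
    exact (W'.smul_mem_iff hsin).1 h2
  have hB : ∀ w ∈ W', opB w ∈ W' := by
    intro w hw
    have h1 := hinv _ (htri (EuclideanSpace.single 1 s) (EuclideanSpace.single 2 s)
      (hnorm 1) (hnorm 2)) w hw
    rw [expEquiv_apply, expOp_apply] at h1
    simp only [formAlpha, formBeta] at h1
    simp at h1
    have hsinh : Real.sinh (s * s) ≠ 0 := (Real.sinh_pos_iff.2 hss).ne'
    have h2 := W'.sub_mem (W'.smul_mem (Real.cosh (s * s)) hw) h1
    rw [sub_sub_cancel] at h2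
    exact (W'.smul_mem_iff hsinh).1 h2
  have hexp : ∀ a b, ∀ w ∈ W', expOp a b w ∈ W' := by
    intro a b w hw
    rw [expOp_apply]
    exact W'.add_mem (W'.sub_mem (W'.sub_mem (W'.smul_mem _ hw) (W'.smul_mem _ (hA _ hw)))
      (W'.smul_mem _ (hB _ hw))) (W'.smul_mem _ (hA _ (hB _ hw)))
  have hG : ∀ w ∈ W', linAct genG w ∈ W' := by
    intro w hw
    obtain ⟨a, b, hab⟩ := exists_isCoverTransport_genG x
    have h1 := hab.trans (isCoverTransport_smul genG⁻¹ (genG • x))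
    rw [inv_smul_smul] at h1
    have hgg : genG⁻¹ = genG := inv_eq_of_mul_eq_one_left (Subtype.ext unitG_mul_self)
    rw [hgg] at h1
    -- The loop acts as G after an exponential. The subspace is already stable under exponentials,
    -- so the inverse one is applied first to leave G alone.
    have h2 := hinv _ h1 _ (hexp (-a) (-b) w hw)
    have h3 : expOp a b (expOp (-a) (-b) w) = w := by
      rw [expOp_expOp, neg_add_cancel, neg_add_cancel, expOp_zero]
    have h4 : ((expEquiv a b).trans (linActEquiv genG).toLinearEquiv) (expOp (-a) (-b) w) =
        linAct genG w := congrArg (linAct genG) h3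
    rwa [h4] at h2
  have hcomap : W'.map e.toLinearMap = W :=
    Submodule.map_comap_eq_of_surjective e.surjective W
  rcases eq_bot_or_eq_top hA hB hG with h | h
  · left
    rw [← hcomap, h, Submodule.map_bot]
  · right
    rw [← hcomap, h, Submodule.map_top, LinearEquiv.range]

end ParallelMetrics

end

theorem theorem4 :
    T2Space quotientM ∧ SecondCountableTopology quotientM ∧ ConnectedSpace quotientM ∧
    ¬ SimplyConnectedSpace quotientM ∧
    ∃ _ : IsManifold 𝓘(ℝ, R4) ∞ quotientM,
      IsLocalDiffeomorph 𝓘(ℝ, R4) 𝓘(ℝ, R4) ∞ proj ∧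
      ∃ (D : LinearConnection 𝓘(ℝ, R4) quotientM)
        (g₁ g₂ : SemiRiemannianMetric 𝓘(ℝ, R4) quotientM),
        -- `D` is smooth, and `D`, `g₁`, `g₂` are the projections of `∇`, `K`, `L`
        CovariantDerivative.ContMDiffCovariantDerivative D ∞ ∧
        ProjectsTo proj coverConnection D ∧
        (∀ (x : cover) (v w : TangentSpace 𝓘(ℝ, R4) x),
          g₁.form (proj x) (mfderiv 𝓘(ℝ, R4) 𝓘(ℝ, R4) proj x v)
            (mfderiv 𝓘(ℝ, R4) 𝓘(ℝ, R4) proj x w) = constForm matK v w) ∧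
        (∀ (x : cover) (v w : TangentSpace 𝓘(ℝ, R4) x),
          g₂.form (proj x) (mfderiv 𝓘(ℝ, R4) 𝓘(ℝ, R4) proj x v)
            (mfderiv 𝓘(ℝ, R4) 𝓘(ℝ, R4) proj x w) = constForm matL v w) ∧
        -- the conclusions about them
        g₁.HasSignature 2 2 ∧ g₂.HasSignature 2 2 ∧
        (∀ q : quotientM, LinearIndependent ℝ ![g₁.form q, g₂.form q]) ∧
        g₁.IsParallel D ∧ g₂.IsParallel D ∧
        HasIrreducibleHolonomy D := by
  exact ⟨t2Space_quotientM, secondCountableTopology_quotientM, connectedSpace_quotientM,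
    not_simplyConnectedSpace_quotientM, isManifold_quotientM ∞, isLocalDiffeomorph_proj,
    quotientConnection, quotientMetric isInvariantForm_matK, quotientMetric isInvariantForm_matL,
    contMDiff_quotientConnection, projectsTo_quotientConnection,
    isInvariantForm_matK.quotientForm_mfderiv_proj, isInvariantForm_matL.quotientForm_mfderiv_proj,
    hasSignature_matK, hasSignature_matL, linearIndependent_quotientMetric,
    isParallel_quotientMetric _, isParallel_quotientMetric _,
    hasIrreducibleHolonomy_quotientConnection⟩
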